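/- **Setting.** Let $n\ge 1$, and let $X_n,\dots,X_0$ be reflexive (real) Banach spaces and $Y_{n-1},\dots,Y_0$ (real) Banach spaces with continuous embeddings (injective continuous linear maps) $$X_n \hookrightarrow Y_{n-1} \hookrightarrow X_{n-1} \hookrightarrow \cdots \hookrightarrow X_1 \hookrightarrow Y_0 \hookrightarrow X_0,$$ where the embedding of $X_k$ in $Y_{k-1}$ is compact for every $k\in\{1,\dots,n\}$. Write $\hat X=(X_n,\dots,X_0)$ and $\hat Y=(Y_{n-1},\dots,Y_0)$. Let $I\subset\mathbb R$ be an interval (bounded or not, with or without its end points) with $0\in I$, endowed with the Lebesgue measure. Let $\hat p=(p_n,\dots,p_0)\in[1,\infty]^{n+1}$ be such that $p_{k-1}>1$ for every $k\in\{1,\dots,n\}$ with $p_k=\infty$ (no condition if all $p_k$ are finite), and let $\tilde p=(p_n,\dots,p_1)$. A locally integrable $v:I\to X_{n-k}$ is the weak $k$-th derivative $u^{(k)}$ of a locally integrable $u:I\to X_n$ if $\int_I \varphi^{(k)}u\,dt=(-1)^k\int_I\varphi v\,dt$ in $X_{n-k}$ for all $\varphi\in C_c^\infty(\mathring I,\mathbb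 R)$; local integrability is meant on the interior $\mathring I$, and $u^{(0)}=u$. For a continuous $\omega:\mathbb R\to(0,\infty)$ let $L^p_\omega(I,X)$ be the space of (classes of) strongly measurable $u:I\to X$ with $\omega u\in L^p(I,X)$, with the norm $\|u\|_{L^p_\omega(I,X)}=\|\omega u\|_{L^p(I,X)}$, and let $$W^{n,\hat p}_\omega(I,\hat X)=\{u\in L^{p_n}_\omega(I,X_n) : u^{(k)}\text{ exists and lies in }L^{p_{n-k}}_\omega(I,X_{n-k})\text{ for }1\le k\le n\},\qquad \|u\|_{W^{n,\hat p}_\omega(I,\hat X)}=\sum_{k=0}^n\|u^{(k)}\|_{L^{p_{n-k}}_\omega(I,X_{n-k})}.$$ The space $W^{n-1,\tilde p}_\omega(I,\hat Y)$ is defined in the same way from the tuples $\hat Y$ and $\tilde p$: its norm is $\sum_{k=0}^{n-1}\|u^{(k)}\|_{L^{p_{n-k}}_\omega(I,Y_{n-1-k})}$. Let $(\omega_m)_{m\ge0}$ be scaled weights, i.e. continuous functions $\omega_m:\mathbb R\to(0,\infty)$ such that for all $m<l$ there exist $T\ge0$ and $D>0$ with: (i) $\omega_m(t)/\omega_l(t)\to0$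 as $t\to\pm\infty$; (ii) $\frac{\omega_m(t_1)}{\omega_l(t_1)}<D\,\frac{\omega_m(t_2)}{\omega_l(t_2)}$ whenever $t_1>t_2>T$; (iii) the same inequality whenever $t_1<t_2<-T$. **Proposition.** The embedding of $X_n$ in $Y_{n-1}$ induces a well-defined, injective, continuous linear map $$W^{n,\hat p}_{\omega_n}(I,\hat X)\hookrightarrow W^{n-1,\tilde p}_{\omega_{n-1}}(I,\hat Y),$$ and this embedding is compact. -/

import Mathlib

open MeasureTheory Filter Topology
open scoped ENNReal

/-- A real Banach space is reflexive if the canonical map into its bidual is onto. -/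
def IsReflexiveSpace (E : Type*) [NormedAddCommGroup E] [NormedSpace ℝ E] : Prop :=
  Function.Surjective (NormedSpace.inclusionInDoubleDual ℝ E)

/-- `v` is a weak `k`-th derivative on `I` of `u`, where the space of values `E` of `u` is mapped
by `e` to the space of values `F` of `v`. The test functions are the elements of
`C_c^∞(int I, ℝ)`; local integrability makes all the integrals meaningful. -/
def IsWeakDeriv {E F : Type*} [NormedAddCommGroup E] [NormedSpace ℝ E]
    [NormedAddCommGroup F] [NormedSpace ℝ F]
    (I : Set ℝ) (k : ℕ) (e : E →L[ℝ] F) (u : ℝ → E) (v : ℝ → F) : Prop :=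
  LocallyIntegrableOn u (interior I) ∧ LocallyIntegrableOn v (interior I) ∧
    ∀ φ : ℝ → ℝ, ContDiff ℝ (⊤ : ℕ∞) φ → HasCompactSupport φ → tsupport φ ⊆ interior I →
      ∫ t in I, iteratedDeriv k φ t • e (u t) = (-1 : ℝ) ^ k • ∫ t in I, φ t • v t

section WeakDerivLemmas

variable {E F : Type*} [NormedAddCommGroup E] [NormedSpace ℝ E]
    [NormedAddCommGroup F] [NormedSpace ℝ F]

/-- A continuous test function supported in the interior of `I` times a locally integrable
function is integrable. -/
theorem integrable_test_smul {I : Set ℝ} {g : ℝ → ℝ} {v : ℝ → F} (hg : Continuous g)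
    (hc : HasCompactSupport g) (hs : tsupport g ⊆ interior I)
    (hv : LocallyIntegrableOn v (interior I)) : Integrable (fun t => g t • v t) := by
  have h1 : IntegrableOn v (tsupport g) := hv.integrableOn_compact_subset hs hc
  have h2 : IntegrableOn (fun t => g t • v t) (tsupport g) :=
    h1.continuousOn_smul hg.continuousOn hc
  refine (integrableOn_iff_integrable_of_support_subset ?_).1 h2
  intro t ht
  apply subset_tsupport g
  intro h0
  exact ht (by simp [h0])

theorem iteratedDeriv_test {I : Set ℝ} {φ : ℝ → ℝ} (k : ℕ) (hφ : ContDiff ℝ (⊤ : ℕ∞) φ)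
    (hc : HasCompactSupport φ) (hs : tsupport φ ⊆ interior I) :
    Continuous (iteratedDeriv k φ) ∧ HasCompactSupport (iteratedDeriv k φ) ∧
      tsupport (iteratedDeriv k φ) ⊆ interior I := by
  have hsub : tsupport (iteratedDeriv k φ) ⊆ tsupport φ := by
    refine closure_minimal ?_ (isClosed_tsupport φ)
    intro t ht
    apply tsupport_iteratedFDeriv_subset (𝕜 := ℝ) k
    apply subset_tsupport
    intro h0
    exact ht (by simp [iteratedDeriv, h0])
  exact ⟨hφ.continuous_iteratedDeriv k (by exact_mod_cast le_top),
    hc.of_isClosed_subset (isClosed_tsupport _) hsub, hsub.trans hs⟩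

theorem integrable_iteratedDeriv_smul {I : Set ℝ} {φ : ℝ → ℝ} {u : ℝ → E} (k : ℕ)
    (e : E →L[ℝ] F) (hφ : ContDiff ℝ (⊤ : ℕ∞) φ)
    (hc : HasCompactSupport φ) (hs : tsupport φ ⊆ interior I)
    (hu : LocallyIntegrableOn u (interior I)) :
    Integrable (fun t => iteratedDeriv k φ t • e (u t)) := by
  obtain ⟨h1, h2, h3⟩ := iteratedDeriv_test k hφ hc hs
  simpa using e.integrable_comp (integrable_test_smul h1 h2 h3 hu)

theorem IsWeakDeriv.add {I : Set ℝ} {k : ℕ} {e : E →L[ℝ] F} {u u' : ℝ → E} {v v' : ℝ → F}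
    (h : IsWeakDeriv I k e u v) (h' : IsWeakDeriv I k e u' v') :
    IsWeakDeriv I k e (u + u') (v + v') := by
  refine ⟨h.1.add h'.1, h.2.1.add h'.2.1, fun φ hφ hc hs => ?_⟩
  have i1 := (integrable_iteratedDeriv_smul k e hφ hc hs h.1).integrableOn (s := I)
  have i2 := (integrable_iteratedDeriv_smul k e hφ hc hs h'.1).integrableOn (s := I)
  have i3 := (integrable_test_smul hφ.continuous hc hs h.2.1).integrableOn (s := I)
  have i4 := (integrable_test_smul hφ.continuous hc hs h'.2.1).integrableOn (s := I)
  simp only [Pi.add_apply, map_add, smul_add]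
  rw [integral_add i1 i2, integral_add i3 i4, smul_add, h.2.2 φ hφ hc hs, h'.2.2 φ hφ hc hs]

theorem IsWeakDeriv.smul {I : Set ℝ} {k : ℕ} {e : E →L[ℝ] F} {u : ℝ → E} {v : ℝ → F}
    (c : ℝ) (h : IsWeakDeriv I k e u v) : IsWeakDeriv I k e (c • u) (c • v) := by
  refine ⟨h.1.smul c, h.2.1.smul c, fun φ hφ hc hs => ?_⟩
  simp only [Pi.smul_apply, map_smul, smul_comm _ c]
  rw [integral_smul, integral_smul, h.2.2 φ hφ hc hs, smul_comm]

/-- On an interval, being equal a.e. and being equal a.e. on the interior are the same. -/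
theorem restrict_interior_eq (I : Set ℝ) [I.OrdConnected] :
    (volume : Measure ℝ).restrict (interior I) = volume.restrict I := by
  refine Measure.restrict_congr_set ?_
  exact interior_ae_eq_of_null_frontier
    ((Set.OrdConnected.convex (s := I) inferInstance).addHaar_frontier volume)

theorem IsWeakDeriv.congr {I : Set ℝ} [I.OrdConnected] {k : ℕ} {e : E →L[ℝ] F} {u u' : ℝ → E}
    {v v' : ℝ → F} (h : IsWeakDeriv I k e u v) (hu : u =ᵐ[volume.restrict I] u')
    (hv : v =ᵐ[volume.restrict I] v') : IsWeakDeriv I k e u' v' := by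
  have key : ∀ {G : Type _} [NormedAddCommGroup G] {f g : ℝ → G},
      f =ᵐ[volume.restrict I] g → LocallyIntegrableOn f (interior I) →
      LocallyIntegrableOn g (interior I) := by
    intro G _ f g hfg hf
    rw [locallyIntegrableOn_iff isOpen_interior.isLocallyClosed] at hf ⊢
    intro K hK hKc
    exact (hf K hK hKc).congr_fun_ae
      (ae_mono (Measure.restrict_mono (hK.trans interior_subset) le_rfl) hfg)
  refine ⟨key hu h.1, ?_, fun φ hφ hc hs => ?_⟩
  · rw [locallyIntegrableOn_iff isOpen_interior.isLocallyClosed]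
    intro K hK hKc
    exact (h.2.1.integrableOn_compact_subset hK hKc).congr_fun_ae
      (ae_mono (Measure.restrict_mono (hK.trans interior_subset) le_rfl) hv)
  have := h.2.2 φ hφ hc hs
  rw [integral_congr_ae (g := fun t => iteratedDeriv k φ t • e (u' t)),
    integral_congr_ae (f := fun t => φ t • v t) (g := fun t => φ t • v' t)] at this
  · exact this
  · filter_upwards [hv] with t ht using by simp [ht]
  · filter_upwards [hu] with t ht using by simp [ht]

/-- Weak derivatives are unique. -/
theorem IsWeakDeriv.unique [CompleteSpace F] {I : Set ℝ} [I.OrdConnected] {k : ℕ}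
    {e : E →L[ℝ] F} {u : ℝ → E} {v v' : ℝ → F}
    (h : IsWeakDeriv I k e u v) (h' : IsWeakDeriv I k e u v') :
    v =ᵐ[volume.restrict I] v' := by
  have h0 : ∀ᵐ t, t ∈ interior I → (v - v') t = 0 := by
    refine isOpen_interior.ae_eq_zero_of_integral_contDiff_smul_eq_zero
      (h.2.1.sub h'.2.1) fun φ hφ hc hs => ?_
    have i3 := integrable_test_smul hφ.continuous hc hs h.2.1
    have i4 := integrable_test_smul hφ.continuous hc hs h'.2.1
    have e1 : ∫ t in I, φ t • v t = ∫ t in I, φ t • v' t := by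
      have := (h.2.2 φ hφ hc hs).symm.trans (h'.2.2 φ hφ hc hs)
      exact smul_right_injective F (pow_ne_zero k (by norm_num : (-1 : ℝ) ≠ 0)) this
    have e2 : ∀ w : ℝ → F, ∫ t in I, φ t • w t = ∫ t, φ t • w t := by
      intro w
      refine setIntegral_eq_integral_of_forall_compl_eq_zero fun t ht => ?_
      have : t ∉ tsupport φ := fun hh => ht (interior_subset (hs hh))
      simp [image_eq_zero_of_notMem_tsupport this]
    simp only [Pi.sub_apply, smul_sub]
    rw [integral_sub i3 i4, ← e2, ← e2, e1, sub_self]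
  rw [← restrict_interior_eq I]
  filter_upwards [(ae_restrict_iff' isOpen_interior.measurableSet).2 h0] with t ht
  simpa [sub_eq_zero] using ht

end WeakDerivLemmas

section BochnerSobolev

variable {X : ℕ → Type*} [∀ k, NormedAddCommGroup (X k)] [∀ k, NormedSpace ℝ (X k)]

/-- A chain `X 0 → X 1 → X 2 → ⋯` of continuous linear maps, composed from `X 0` to `X k`. -/
def chainMap (ι : ∀ k, X k →L[ℝ] X (k + 1)) : ∀ k, X 0 →L[ℝ] X k
  | 0 => ContinuousLinearMap.id ℝ (X 0)
  | k + 1 => (ι k).comp (chainMap ι k)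

/-- The vector space underlying the weighted Bochner-Sobolev space of order `n` on `I`.
A tuple `(X_n, …, X_0)` is numbered here in the order of listing: `X k = X_{n-k}` is the space
in which the `k`-th derivative takes its values and `p k = p_{n-k}` is the exponent for the `k`-th
derivative, `0 ≤ k ≤ n`; entries with `k > n` play no role. The members are the
(classes of) strongly measurable functions `u : I → X 0` that have weak derivatives `u^(k)` with
`ω u^(k) ∈ L^(p k)(I, X k)` for all `k ≤ n`, where `u^(0) = u`. -/
def bochnerSobolevSubmodule (n : ℕ) (ι : ∀ k, X k →L[ℝ] X (k + 1)) (p : ℕ → ℝ≥0∞)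
    (ω : C(ℝ, Set.Ioi (0 : ℝ))) (I : Set ℝ) [I.OrdConnected] :
    Submodule ℝ (ℝ →ₘ[volume.restrict I] X 0) where
  carrier := {u | ∀ k ≤ n, ∃ v : ℝ →ₘ[volume.restrict I] X k,
    IsWeakDeriv I k (chainMap ι k) u v ∧
      MemLp (fun t => (ω t : ℝ) • v t) (p k) (volume.restrict I)}
  add_mem' := by
    intro a b ha hb k hk
    obtain ⟨v, hv, hv'⟩ := ha k hk
    obtain ⟨w, hw, hw'⟩ := hb k hk
    refine ⟨v + w, (hv.add hw).congr (AEEqFun.coeFn_add a b).symm (AEEqFun.coeFn_add v w).symm, ?_⟩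
    refine (hv'.add hw').ae_eq ?_
    filter_upwards [AEEqFun.coeFn_add v w] with t ht
    simp [ht]
  zero_mem' := by
    intro k hk
    have h0 : ∀ j, (0 : ℝ → X j) =ᵐ[volume.restrict I] (0 : ℝ →ₘ[volume.restrict I] X j) :=
      fun j => AEEqFun.coeFn_zero.symm
    refine ⟨0, IsWeakDeriv.congr (u := 0) (v := 0) ⟨locallyIntegrableOn_zero,
      locallyIntegrableOn_zero, by simp⟩ (h0 0) (h0 k), ?_⟩
    refine (MemLp.zero (ε := X k)).ae_eq ?_
    filter_upwards [h0 k] with t ht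
    simp [← ht]
  smul_mem' := by
    intro c a ha k hk
    obtain ⟨v, hv, hv'⟩ := ha k hk
    refine ⟨c • v, (hv.smul c).congr (AEEqFun.coeFn_smul c a).symm (AEEqFun.coeFn_smul c v).symm, ?_⟩
    refine (hv'.const_smul c).ae_eq ?_
    filter_upwards [AEEqFun.coeFn_smul c v] with t ht
    simp [ht, smul_comm c]

/-- The weighted Bochner-Sobolev space of order `n` on `I`. -/
def BochnerSobolev (n : ℕ) (ι : ∀ k, X k →L[ℝ] X (k + 1)) (p : ℕ → ℝ≥0∞)
    (ω : C(ℝ, Set.Ioi (0 : ℝ))) (I : Set ℝ) [I.OrdConnected] : Type _ :=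
  bochnerSobolevSubmodule n ι p ω I

namespace BochnerSobolev

variable {n : ℕ} {ι : ∀ k, X k →L[ℝ] X (k + 1)} {p : ℕ → ℝ≥0∞}
  {ω : C(ℝ, Set.Ioi (0 : ℝ))} {I : Set ℝ} [I.OrdConnected]

noncomputable instance : AddCommGroup (BochnerSobolev n ι p ω I) :=
  inferInstanceAs (AddCommGroup (bochnerSobolevSubmodule n ι p ω I))

noncomputable instance : Module ℝ (BochnerSobolev n ι p ω I) :=
  inferInstanceAs (Module ℝ (bochnerSobolevSubmodule n ι p ω I))

/-- A member of the Bochner-Sobolev space as a function, up to equality almost everywhere. -/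
def toAEEqFun (u : BochnerSobolev n ι p ω I) : ℝ →ₘ[volume.restrict I] X 0 := u.1

theorem exists_deriv (u : BochnerSobolev n ι p ω I) (k : Fin (n + 1)) :
    ∃ v : ℝ →ₘ[volume.restrict I] X k,
      IsWeakDeriv I k (chainMap ι k) u.toAEEqFun v ∧
        MemLp (fun t => (ω t : ℝ) • v t) (p k) (volume.restrict I) :=
  u.2 k (Nat.le_of_lt_succ k.2)

/-- The weak derivative `u^(k)`, `0 ≤ k ≤ n`. -/
noncomputable def deriv (u : BochnerSobolev n ι p ω I) (k : Fin (n + 1)) :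
    ℝ →ₘ[volume.restrict I] X k :=
  (u.exists_deriv k).choose

theorem isWeakDeriv_deriv (u : BochnerSobolev n ι p ω I) (k : Fin (n + 1)) :
    IsWeakDeriv I k (chainMap ι k) u.toAEEqFun (u.deriv k) :=
  (u.exists_deriv k).choose_spec.1

theorem memLp_deriv (u : BochnerSobolev n ι p ω I) (k : Fin (n + 1)) :
    MemLp (fun t => (ω t : ℝ) • u.deriv k t) (p k) (volume.restrict I) :=
  (u.exists_deriv k).choose_spec.2

variable [∀ k, CompleteSpace (X k)]

theorem deriv_add (u v : BochnerSobolev n ι p ω I) (k : Fin (n + 1)) :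
    (u + v).deriv k =ᵐ[volume.restrict I] u.deriv k + v.deriv k :=
  ((u + v).isWeakDeriv_deriv k).unique
    (((u.isWeakDeriv_deriv k).add (v.isWeakDeriv_deriv k)).congr
      (AEEqFun.coeFn_add u.toAEEqFun v.toAEEqFun).symm (ae_eq_refl _))

theorem deriv_smul (c : ℝ) (u : BochnerSobolev n ι p ω I) (k : Fin (n + 1)) :
    (c • u).deriv k =ᵐ[volume.restrict I] c • ⇑(u.deriv k) :=
  ((c • u).isWeakDeriv_deriv k).unique
    (((u.isWeakDeriv_deriv k).smul c).congr
      (AEEqFun.coeFn_smul c u.toAEEqFun).symm (ae_eq_refl _))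

/-- The zeroth derivative of `u` is `u`. -/
theorem deriv_zero (u : BochnerSobolev n ι p ω I) :
    u.deriv 0 =ᵐ[volume.restrict I] u.toAEEqFun := by
  refine (u.isWeakDeriv_deriv 0).unique ⟨(u.isWeakDeriv_deriv 0).1, (u.isWeakDeriv_deriv 0).1, ?_⟩
  intro φ _ _ _
  simp only [chainMap, Fin.coe_ofNat_eq_mod, Nat.zero_mod, iteratedDeriv_zero, pow_zero]
  exact (one_smul ℝ _).symm

/-- The map `u ↦ (ω u, ω u', …, ω u^(n))` into the `ℓ¹`-product of the spaces `L^(p k)(I, X k)`. -/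
noncomputable def weightedDerivs [∀ k, Fact (1 ≤ p k)] : BochnerSobolev n ι p ω I →ₗ[ℝ]
    PiLp 1 (fun k : Fin (n + 1) => Lp (X k) (p k) (volume.restrict I)) where
  toFun u := WithLp.toLp 1 fun k => (u.memLp_deriv k).toLp
  map_add' u v := by
    apply WithLp.ofLp_injective
    funext k
    change ((u + v).memLp_deriv k).toLp = (u.memLp_deriv k).toLp + (v.memLp_deriv k).toLp
    rw [← MemLp.toLp_add, MemLp.toLp_eq_toLp_iff]
    filter_upwards [deriv_add u v k] with t ht
    simp [ht]
  map_smul' c u := by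
    apply WithLp.ofLp_injective
    funext k
    change ((c • u).memLp_deriv k).toLp = c • (u.memLp_deriv k).toLp
    rw [← MemLp.toLp_const_smul, MemLp.toLp_eq_toLp_iff]
    filter_upwards [deriv_smul c u k] with t ht
    simp [ht, smul_comm c]

theorem weightedDerivs_injective [∀ k, Fact (1 ≤ p k)] :
    Function.Injective (weightedDerivs (n := n) (ι := ι) (p := p) (ω := ω) (I := I)) := by
  intro u v h
  have h0 : (u.memLp_deriv 0).toLp = (v.memLp_deriv 0).toLp :=
    congrArg (fun w : PiLp 1 (fun k : Fin (n + 1) => Lp (X k) (p k) (volume.restrict I)) => w 0) h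
  rw [MemLp.toLp_eq_toLp_iff] at h0
  apply Subtype.ext
  apply AEEqFun.ext
  filter_upwards [h0, u.deriv_zero, v.deriv_zero] with t ht hu hv
  change u.toAEEqFun t = v.toAEEqFun t
  rw [← hu, ← hv]
  exact smul_right_injective _ (ω t).2.ne' ht

/-- The norm of `u` is `∑_{k ≤ n} ‖ω u^(k)‖` with the norm of `L^(p k)(I, X k)` in the `k`-th
summand. -/
noncomputable instance [∀ k, Fact (1 ≤ p k)] : NormedAddCommGroup (BochnerSobolev n ι p ω I) :=
  NormedAddCommGroup.induced _ _
    (weightedDerivs (n := n) (ι := ι) (p := p) (ω := ω) (I := I)) weightedDerivs_injective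

noncomputable instance [∀ k, Fact (1 ≤ p k)] : NormedSpace ℝ (BochnerSobolev n ι p ω I) :=
  NormedSpace.induced ℝ _ _ (weightedDerivs (n := n) (ι := ι) (p := p) (ω := ω) (I := I))

theorem norm_eq [∀ k, Fact (1 ≤ p k)] (u : BochnerSobolev n ι p ω I) :
    ‖u‖ = ∑ k : Fin (n + 1),
      (eLpNorm (fun t => (ω t : ℝ) • u.deriv k t) (p k) (volume.restrict I)).toReal := by
  change ‖weightedDerivs u‖ = _
  rw [PiLp.norm_eq_of_L1]
  exact Finset.sum_congr rfl fun k _ => Lp.norm_toLp _ (u.memLp_deriv k)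

end BochnerSobolev

end BochnerSobolev

/-- Scaled weights: continuous weights `ω n : ℝ → (0, ∞)` whose quotients `ω m / ω n`, `m < n`,
tend to `0` at `±∞` and are monotone far out up to a constant factor. -/
def IsScaledWeights (ω : ℕ → C(ℝ, Set.Ioi (0 : ℝ))) : Prop :=
  ∀ m n : ℕ, m < n → ∃ T : ℝ, 0 ≤ T ∧ ∃ D : ℝ, 0 < D ∧
    Tendsto (fun t => (ω m t : ℝ) / (ω n t : ℝ)) atTop (𝓝 0) ∧
    Tendsto (fun t => (ω m t : ℝ) / (ω n t : ℝ)) atBot (𝓝 0) ∧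
    (∀ t₁ t₂ : ℝ, t₂ < t₁ → T < t₂ →
      (ω m t₁ : ℝ) / (ω n t₁ : ℝ) < D * ((ω m t₂ : ℝ) / (ω n t₂ : ℝ))) ∧
    (∀ t₁ t₂ : ℝ, t₁ < t₂ → t₂ < -T →
      (ω m t₁ : ℝ) / (ω n t₁ : ℝ) < D * ((ω m t₂ : ℝ) / (ω n t₂ : ℝ)))

/-! The embedding acts derivative by derivative: the `k`-th weak derivative of the image of `u` is
`i k` applied to `u^(k)`. It is well defined because `ω (n-1) / ω n` is bounded: it tends to `0` at
both ends and is continuous in between. For compactness it is enough to treat each `k < n`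
separately, with the pair `u^(k)`, `u^(k+1)` along `X k → Y k → X (k+1)`. This is a weighted
Aubin-Lions-Simon lemma, `hasFiniteNets_weighted_of_isWeakDeriv`.

Ehrling's inequality, combined with the decay of the weight quotient, bounds `ω' ‖i x‖` by `ε ω ‖x‖`
plus a multiple of `‖j (i x)‖` that is present only for `|t| < R`. The first term is uniformly small
on the unit ball, so it remains to find finite nets for `j ∘ i ∘ u^(k)` on a bounded interval
(`hasFiniteNets_eLpNorm_of_isWeakDeriv`). There the function differs from its mean over a short
window by at most twice the integral of the norm of its weak derivative. By
`exists_eLpNorm_window_le` this error tends to `0` in `L^p` with the window length; for `p = ∞` this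
needs an exponent `q > 1` for the derivative. The finitely many means lie in a compact set because
`j ∘ i` is compact.

Total boundedness of every weighted derivative gives a compact operator because the target is
complete: weak derivative identities are closed conditions on the tuple of derivatives
(`range_weightedDerivs`), so `weightedDerivs` is a closed embedding. -/

/-! ### Finite nets and total boundedness -/

/-- Every radius admits a finite net for the distance-like function `d`. -/
def HasFiniteNets {α : Type*} (d : α → α → ℝ≥0∞) : Prop :=
  ∀ ε : ℝ≥0∞, 0 < ε → ∃ t : Set α, t.Finite ∧ ∀ a, ∃ b ∈ t, d a b ≤ ε

/-- Half of the radius pays for the error and half for a net of `d'`. Both `d'` and `C` may depend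
on `ε`, so Ehrling's constant and the window length can be chosen after the accuracy. -/
theorem HasFiniteNets.of_forall_le_add {α : Type*} {d : α → α → ℝ≥0∞}
    (h : ∀ ε : ℝ≥0∞, 0 < ε → ε ≠ ∞ → ∃ d' : α → α → ℝ≥0∞, HasFiniteNets d' ∧
      ∃ C : ℝ≥0∞, C ≠ ∞ ∧ ∀ a b, d a b ≤ ε + C * d' a b) : HasFiniteNets d := by
  have key : ∀ ε : ℝ≥0∞, 0 < ε → ε ≠ ∞ → ∃ t : Set α, t.Finite ∧ ∀ a, ∃ b ∈ t, d a b ≤ ε := by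
    intro ε hε hε'
    have h2 : 0 < ε / 2 := ENNReal.half_pos hε.ne'
    obtain ⟨d', hd', C, hC, hle⟩ := h (ε / 2) h2
      (ne_top_of_le_ne_top hε' ENNReal.half_le_self)
    have h3 : 0 < ε / 2 / (C + 1) :=
      ENNReal.div_pos h2.ne' (ENNReal.add_ne_top.2 ⟨hC, ENNReal.one_ne_top⟩)
    obtain ⟨t, ht, hcov⟩ := hd' _ h3
    refine ⟨t, ht, fun a => ?_⟩
    obtain ⟨b, hb, hab⟩ := hcov a
    refine ⟨b, hb, (hle a b).trans ?_⟩
    calc ε / 2 + C * d' a b ≤ ε / 2 + (C + 1) * (ε / 2 / (C + 1)) := by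
          gcongr
          exact le_self_add
      _ ≤ ε / 2 + ε / 2 := by gcongr; exact ENNReal.mul_div_le
      _ = ε := ENNReal.add_halves ε
  intro ε hε
  by_cases hε' : ε = ∞
  · obtain ⟨t, ht, hcov⟩ := key 1 one_pos ENNReal.one_ne_top
    refine ⟨t, ht, fun a => ?_⟩
    obtain ⟨b, hb, -⟩ := hcov a
    exact ⟨b, hb, by simp [hε']⟩
  · exact key ε hε hε'

theorem HasFiniteNets.congr {α : Type*} {d d' : α → α → ℝ≥0∞} (h : HasFiniteNets d)
    (hd : ∀ a b, d' a b = d a b) : HasFiniteNets d' := by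
  simpa only [HasFiniteNets, hd] using h

/-- The centres can be taken in the range of `g` and pulled back to indices. Nets indexed by `α`
itself make the triangle inequality for `d` unnecessary. -/
theorem hasFiniteNets_edist {α E : Type*} [PseudoEMetricSpace E] {g : α → E} {K : Set E}
    (hK : TotallyBounded K) (hg : ∀ a, g a ∈ K) :
    HasFiniteNets fun a b => edist (g a) (g b) := by
  intro ε hε
  obtain ⟨t, htK, htf, hcov⟩ := EMetric.totallyBounded_iff'.1
    (hK.subset (Set.range_subset_iff.2 hg)) ε hε
  rcases isEmpty_or_nonempty α with hα | hα
  · exact ⟨∅, Set.finite_empty, fun a => hα.elim a⟩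
  have htK' : ∀ y ∈ t, ∃ a, g a = y := fun y hy => htK hy
  choose! f hf using htK'
  refine ⟨f '' t, htf.image f, fun a => ?_⟩
  obtain ⟨y, hy, hay⟩ := Set.mem_iUnion₂.1 (hcov (Set.mem_range_self a))
  exact ⟨f y, Set.mem_image_of_mem f hy, by beta_reduce; rw [hf y hy]; exact (Metric.mem_eball.1 hay).le⟩

theorem HasFiniteNets.totallyBounded {α E : Type*} [PseudoEMetricSpace E] {g : α → E}
    (h : HasFiniteNets fun a b => edist (g a) (g b)) : TotallyBounded (Set.range g) := by
  rw [EMetric.totallyBounded_iff]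
  intro ε hε
  obtain ⟨δ, hδ, hδε⟩ := exists_between hε
  obtain ⟨t, ht, hcov⟩ := h δ hδ
  refine ⟨g '' t, ht.image g, ?_⟩
  rintro _ ⟨a, rfl⟩
  obtain ⟨b, hb, hab⟩ := hcov a
  exact Set.mem_iUnion₂.2 ⟨g b, Set.mem_image_of_mem g hb,
    Metric.mem_eball.2 (hab.trans_lt hδε)⟩

/-! ### Interpolation between norms under a compact map -/

/-- Ehrling's inequality. -/
theorem IsCompactOperator.exists_norm_le_add {X Y Z : Type*}
    [NormedAddCommGroup X] [NormedSpace ℝ X] [NormedAddCommGroup Y] [NormedSpace ℝ Y]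
    [NormedAddCommGroup Z] [NormedSpace ℝ Z] {i : X →L[ℝ] Y} (hi : IsCompactOperator i)
    {j : Y →L[ℝ] Z} (hj : Function.Injective j) {η : ℝ} (hη : 0 < η) :
    ∃ C : ℝ, 0 ≤ C ∧ ∀ x, ‖i x‖ ≤ η * ‖x‖ + C * ‖j (i x)‖ := by
  have hK : IsCompact (closure (i '' Metric.closedBall 0 1)) :=
    IsCompactOperator.isCompact_closure_image_closedBall (f := (i : X →ₗ[ℝ] Y)) hi 1
  -- Cutting off the norms below `η` leaves a compact set without `0`, on which the injective `j` is
  -- bounded away from `0`.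
  have hK' : IsCompact (closure (i '' Metric.closedBall 0 1) ∩ {y | η ≤ ‖y‖}) :=
    hK.inter_right (isClosed_le continuous_const continuous_norm)
  obtain ⟨c, hc, hcle⟩ : ∃ c : ℝ, 0 < c ∧
      ∀ y ∈ closure (i '' Metric.closedBall 0 1) ∩ {y | η ≤ ‖y‖}, c ≤ ‖j y‖ := by
    refine hK'.exists_forall_le' (f := fun y => ‖j y‖) (a := (0 : ℝ)) (by fun_prop) ?_
    rintro y ⟨-, hy⟩
    refine norm_pos_iff.2 fun h0 => ?_
    have hy0 : y = 0 := hj (by rw [h0, map_zero])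
    rw [Set.mem_ofPred_eq, hy0, norm_zero] at hy
    exact hη.not_ge hy
  -- If `‖i x‖ ≥ η ‖x‖`, the normalised `x` is sent into that compact set, so `c ‖x‖ ≤ ‖j (i x)‖`
  -- and the second term suffices. Otherwise the first one does.
  refine ⟨‖i‖ / c, by positivity, fun x => ?_⟩
  rcases eq_or_ne x 0 with rfl | hx
  · simp
  have hx0 : 0 < ‖x‖ := norm_pos_iff.2 hx
  by_cases hcase : η * ‖x‖ ≤ ‖i x‖
  · have hmem : i (‖x‖⁻¹ • x) ∈ closure (i '' Metric.closedBall 0 1) ∩ {y | η ≤ ‖y‖} := by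
      refine ⟨subset_closure ⟨_, ?_, rfl⟩, ?_⟩
      · simp [norm_smul, hx0.ne']
      · rw [Set.mem_ofPred_eq, map_smul, norm_smul, norm_inv, norm_norm, inv_mul_eq_div,
          le_div_iff₀ hx0]
        exact hcase
    have h1 := hcle _ hmem
    rw [map_smul, map_smul, norm_smul, norm_inv, norm_norm, inv_mul_eq_div, le_div_iff₀ hx0] at h1
    have h2 : ‖i‖ / c * (c * ‖x‖) ≤ ‖i‖ / c * ‖j (i x)‖ := by gcongr
    have h3 : ‖i‖ / c * (c * ‖x‖) = ‖i‖ * ‖x‖ := by field_simp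
    have h4 := i.le_opNorm x
    have h5 : 0 ≤ η * ‖x‖ := by positivity
    linarith
  · have : 0 ≤ ‖i‖ / c * ‖j (i x)‖ := by positivity
    linarith

/-! ### Oscillation controlled by the weak derivative -/

/-- A smooth function with vanishing integral is the derivative of a test function. -/
theorem exists_primitive_of_integral_eq_zero {G : ℝ → ℝ} {a b : ℝ} (hG : ContDiff ℝ (⊤ : ℕ∞) G)
    (hs : Function.support G ⊆ Set.Icc a b) (h0 : ∫ x, G x = 0) :
    ∃ φ : ℝ → ℝ, ContDiff ℝ (⊤ : ℕ∞) φ ∧ Function.support φ ⊆ Set.Icc a b ∧ _root_.deriv φ = G ∧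
      ∀ x, ‖φ x‖ ≤ ∫ y, ‖G y‖ := by
  have hint : Integrable G :=
    hG.continuous.integrable_of_hasCompactSupport
      (HasCompactSupport.of_support_subset_isCompact isCompact_Icc hs)
  have hz : ∀ x, x ∉ Set.Icc a b → G x = 0 := fun x hx => by
    by_contra h
    exact hx (hs h)
  have hderiv : _root_.deriv (fun x => ∫ y in a..x, G y) = G :=
    funext fun x => Continuous.deriv_integral G hG.continuous a x
  refine ⟨fun x => ∫ y in a..x, G y, ?_, ?_, hderiv, fun x => ?_⟩
  · rw [contDiff_infty_iff_deriv, hderiv]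
    exact ⟨fun x => (intervalIntegral.integral_hasDerivAt_right hint.intervalIntegrable
      (hG.continuous.stronglyMeasurableAtFilter _ _)
      hG.continuous.continuousAt).differentiableAt, hG⟩
  · intro x hx
    by_contra hxab
    apply hx
    simp only [Set.mem_Icc, not_and_or, not_le] at hxab
    rcases hxab with hxa | hxb
    · change ∫ y in a..x, G y = 0
      rw [intervalIntegral.integral_of_ge hxa.le, neg_eq_zero]
      -- Only the end point `a` can meet the support, and it is a null set.
      refine (setIntegral_congr_ae (g := fun _ => (0 : ℝ)) measurableSet_Ioc ?_).trans (by simp)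
      filter_upwards [Measure.ae_ne volume a] with y hya hy
      exact hz y fun h => hya (le_antisymm hy.2 h.1)
    · change ∫ y in a..x, G y = 0
      rcases le_or_gt a x with hax | hax
      · rw [intervalIntegral.integral_of_le hax, ← h0, setIntegral_eq_integral_of_ae_compl_eq_zero]
        filter_upwards [Measure.ae_ne volume a] with y hya hy
        refine hz y fun h => hy ⟨lt_of_le_of_ne h.1 hya.symm, h.2.trans hxb.le⟩
      · have : ∀ y, G y = 0 := fun y => hz y fun h => by linarith [h.1, h.2]
        simp [this]
  · calc ‖∫ y in a..x, G y‖ ≤ ∫ y in Set.uIoc a x, ‖G y‖ :=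
        intervalIntegral.norm_integral_le_integral_norm_uIoc
      _ ≤ ∫ y, ‖G y‖ := setIntegral_le_integral hint.norm (ae_of_all _ fun y => norm_nonneg _)

section Oscillation

variable {E F : Type*} [NormedAddCommGroup E] [NormedSpace ℝ E]
    [NormedAddCommGroup F] [NormedSpace ℝ F]

/-- Having mean zero, `G` is the derivative of a test function bounded by the `L^1` norm of `G`, so
the weak derivative identity moves the integral onto `v`. The margins `α < α'` and `β' < β` keep the
support compact inside the open interval. -/
theorem IsWeakDeriv.enorm_integral_smul_le {I : Set ℝ} {e : E →L[ℝ] F} {u : ℝ → E} {v : ℝ → F}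
    (h : IsWeakDeriv I 1 e u v) {α β : ℝ} (hαβ : Set.Ioo α β ⊆ interior I) {G : ℝ → ℝ}
    (hG : ContDiff ℝ (⊤ : ℕ∞) G) {α' β' : ℝ} (hα : α < α') (hβ : β' < β)
    (hs : Function.support G ⊆ Set.Icc α' β') (h0 : ∫ x, G x = 0) :
    ‖∫ t, G t • e (u t)‖ₑ ≤ ENNReal.ofReal (∫ x, ‖G x‖) * ∫⁻ t in Set.Ioo α β, ‖v t‖ₑ := by
  obtain ⟨φ, hφ, hφs, hφd, hφb⟩ := exists_primitive_of_integral_eq_zero hG hs h0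
  have hsub : Set.Icc α' β' ⊆ Set.Ioo α β := Set.Icc_subset_Ioo hα hβ
  have hts : tsupport φ ⊆ Set.Icc α' β' := closure_minimal hφs isClosed_Icc
  have hw := h.2.2 φ hφ (HasCompactSupport.of_support_subset_isCompact isCompact_Icc hφs)
    (hts.trans (hsub.trans hαβ))
  rw [iteratedDeriv_one, hφd, setIntegral_eq_integral_of_forall_compl_eq_zero] at hw
  · rw [hw, pow_one, neg_one_smul, enorm_neg]
    calc ‖∫ t in I, φ t • v t‖ₑ ≤ ∫⁻ t in I, ‖φ t • v t‖ₑ := enorm_integral_le_lintegral_enorm _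
      _ ≤ ∫⁻ t, (Set.Ioo α β).indicator
            (fun t => ENNReal.ofReal (∫ x, ‖G x‖) * ‖v t‖ₑ) t := by
          refine (setLIntegral_le_lintegral _ _).trans (lintegral_mono fun t => ?_)
          by_cases ht : t ∈ Set.Ioo α β
          · rw [Set.indicator_of_mem ht, enorm_smul]
            gcongr
            rw [← ofReal_norm]
            exact ENNReal.ofReal_le_ofReal (hφb t)
          · have : φ t = 0 := by
              by_contra hne
              exact ht (hsub (hφs hne))
            simp [this]
      _ = _ := by
          rw [lintegral_indicator measurableSet_Ioo, lintegral_const_mul' _ _ ENNReal.ofReal_ne_top]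
  · intro t ht
    have : G t = 0 := by
      by_contra hne
      exact ht (interior_subset (hαβ (hsub (hs hne))))
    simp [this]

/-- The oscillation of a function is bounded by the integral of its weak derivative. -/
theorem IsWeakDeriv.ae_enorm_sub_le [CompleteSpace F] {I : Set ℝ} {e : E →L[ℝ] F} {u : ℝ → E}
    {v : ℝ → F} (h : IsWeakDeriv I 1 e u v) {a b : ℝ} (hab : Set.Ioo a b ⊆ interior I)
    (hu : IntegrableOn u (Set.Ioo a b)) :
    ∃ S : Set ℝ, (∀ᵐ t, t ∈ S) ∧ ∀ α β, Set.Ioo α β ⊆ Set.Ioo a b →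
      ∀ s ∈ S ∩ Set.Ioo α β, ∀ t ∈ S ∩ Set.Ioo α β,
        ‖e (u s) - e (u t)‖ₑ ≤ 2 * ∫⁻ r in Set.Ioo α β, ‖v r‖ₑ := by
  -- The outer radius is twice the inner one; a bounded ratio is what almost everywhere convergence
  -- of the mollifications requires.
  let ρ : ℕ → ContDiffBump (0 : ℝ) := fun m =>
    ⟨1 / (2 * ((m : ℝ) + 1)), 1 / ((m : ℝ) + 1), by positivity, by
      apply one_div_lt_one_div_of_lt <;> nlinarith [(Nat.cast_nonneg m : (0 : ℝ) ≤ m)]⟩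
  have hρ : Tendsto (fun m => (ρ m).rOut) atTop (𝓝 0) := tendsto_one_div_add_atTop_nhds_zero_nat
  have hρ' : ∀ᶠ m in atTop, (ρ m).rOut ≤ 2 * (ρ m).rIn := by
    refine Eventually.of_forall fun m => ?_
    change 1 / ((m : ℝ) + 1) ≤ 2 * (1 / (2 * ((m : ℝ) + 1)))
    field_simp
    exact le_rfl
  let g : ℝ → F := (Set.Ioo a b).indicator fun t => e (u t)
  have hg : Integrable g := (integrable_indicator_iff measurableSet_Ioo).2 (e.integrable_comp hu)
  -- `S` consists of the points where the mollifications converge. It depends only on `(a, b)`, so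
  -- one null set serves all subintervals `(α, β)`.
  refine ⟨{x | Tendsto (fun m => (convolution ((ρ m).normed volume) g
    (ContinuousLinearMap.lsmul ℝ ℝ) volume) x) atTop (𝓝 (g x))},
    ContDiffBump.ae_convolution_tendsto_right_of_locallyIntegrable (μ := volume)
    hρ hρ' hg.locallyIntegrable, fun α β hαβ s hs t ht => ?_⟩
  have hlim := Tendsto.sub (Set.mem_ofPred_eq ▸ hs.1) (Set.mem_ofPred_eq ▸ ht.1)
  simp only [g, Set.indicator_of_mem (hαβ hs.2), Set.indicator_of_mem (hαβ ht.2)] at hlim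
  obtain ⟨r, hr, hrα, hrβ⟩ : ∃ r > 0, α + r < min s t ∧ max s t + r < β := by
    have h1 : α < min s t := lt_min hs.2.1 ht.2.1
    have h2 : max s t < β := max_lt hs.2.2 ht.2.2
    refine ⟨min (min s t - α) (β - max s t) / 2, ?_, ?_, ?_⟩
    · have : 0 < min (min s t - α) (β - max s t) := lt_min (by linarith) (by linarith)
      linarith
    · linarith [min_le_left (min s t - α) (β - max s t)]
    · linarith [min_le_right (min s t - α) (β - max s t)]
  refine le_of_tendsto hlim.enorm ?_
  filter_upwards [hρ.eventually (gt_mem_nhds hr)] with m hm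
  let f := (ρ m).normed volume
  have hfc : ContDiff ℝ (⊤ : ℕ∞) f := (ρ m).contDiff_normed
  have hfi : Integrable f := (ρ m).integrable_normed
  have hfz : ∀ y, r ≤ |y| → f y = 0 := by
    intro y hy
    by_contra hne
    have : y ∈ Function.support f := hne
    rw [(ρ m).support_normed_eq, mem_ball_zero_iff, Real.norm_eq_abs] at this
    exact absurd (this.trans hm) hy.not_gt
  have hi : ∀ x, Integrable fun y => f (x - y) := fun x => hfi.comp_sub_left x
  have h1 : ∀ x, ∫ y, f (x - y) = 1 := fun x => by
    rw [integral_sub_left_eq_self f volume x, (ρ m).integral_normed]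
  -- The difference of the mollifiers centred at `s` and `t` has mean zero, and its `L^1` norm is at
  -- most `2`, the factor in the claim.
  have hG : ContDiff ℝ (⊤ : ℕ∞) fun y => f (s - y) - f (t - y) :=
    (hfc.comp (contDiff_const.sub contDiff_id)).sub (hfc.comp (contDiff_const.sub contDiff_id))
  have hGs : (Function.support fun y => f (s - y) - f (t - y)) ⊆
      Set.Icc (min s t - r) (max s t + r) := by
    intro y hy
    by_contra hyn
    apply hy
    have key : ∀ x, min s t ≤ x → x ≤ max s t → f (x - y) = 0 := by
      intro x hx hx'
      apply hfz
      rw [Set.mem_Icc, not_and_or, not_le, not_le] at hyn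
      rcases hyn with hyn | hyn
      · exact le_trans (by linarith) (le_abs_self _)
      · exact le_trans (by linarith) (neg_le_abs _)
    change f (s - y) - f (t - y) = 0
    rw [key s (min_le_left _ _) (le_max_left _ _), key t (min_le_right _ _) (le_max_right _ _),
      sub_zero]
  have hmain := h.enorm_integral_smul_le (hαβ.trans hab) hG (lt_sub_iff_add_lt.2 hrα) hrβ hGs
    (by rw [integral_sub (hi s) (hi t), h1, h1, sub_self])
  have hconv : ∀ x, (convolution f g (ContinuousLinearMap.lsmul ℝ ℝ) volume) x =
      ∫ y, f (x - y) • g y := fun x => by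
    rw [convolution_eq_swap]
    rfl
  have hgi : ∀ x, Integrable fun y => f (x - y) • g y := fun x => by
    obtain ⟨C, hC⟩ := (ρ m).hasCompactSupport_normed.exists_bound_of_continuous hfc.continuous
    exact hg.bdd_smul C
      (hfc.continuous.comp (continuous_const.sub continuous_id)).aestronglyMeasurable
      (ae_of_all _ fun y => hC _)
  have heq : ∫ y, (f (s - y) - f (t - y)) • e (u y) =
      (convolution f g (ContinuousLinearMap.lsmul ℝ ℝ) volume) s -
      (convolution f g (ContinuousLinearMap.lsmul ℝ ℝ) volume) t := by
    rw [hconv, hconv, ← integral_sub (hgi s) (hgi t)]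
    refine integral_congr_ae (ae_of_all _ fun y => ?_)
    change (f (s - y) - f (t - y)) • e (u y) = f (s - y) • g y - f (t - y) • g y
    rw [← sub_smul]
    by_cases hy : y ∈ Set.Ioo a b
    · simp only [g, Set.indicator_of_mem hy]
    · have : f (s - y) - f (t - y) = 0 := by
        by_contra hne
        have := hGs hne
        exact hy (hαβ ⟨by linarith [this.1], by linarith [this.2]⟩)
      rw [this, zero_smul, zero_smul]
  rw [heq] at hmain
  refine hmain.trans ?_
  gcongr
  rw [← ENNReal.ofReal_ofNat]
  apply ENNReal.ofReal_le_ofReal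
  have hn : ∀ x, ∫ y, ‖f (x - y)‖ = 1 := fun x => by
    rw [← h1 x]
    exact integral_congr_ae (ae_of_all _ fun y => Real.norm_of_nonneg ((ρ m).nonneg_normed _))
  calc ∫ y, ‖f (s - y) - f (t - y)‖ ≤ ∫ y, (‖f (s - y)‖ + ‖f (t - y)‖) :=
        integral_mono ((hi s).sub (hi t)).norm ((hi s).norm.add (hi t).norm)
          fun y => norm_sub_le _ _
    _ = 2 := by rw [integral_add (hi s).norm (hi t).norm, hn, hn]; norm_num

/-- A function is close to its mean if its weak derivative has a small integral. -/
theorem IsWeakDeriv.ae_enorm_sub_average_le [CompleteSpace E] [CompleteSpace F] {I : Set ℝ}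
    {e : E →L[ℝ] F} {u : ℝ → E} {v : ℝ → F} (h : IsWeakDeriv I 1 e u v) {a b : ℝ}
    (hab : Set.Ioo a b ⊆ interior I) (hu : IntegrableOn u (Set.Ioo a b)) :
    ∀ᵐ s, ∀ α β, Set.Ioo α β ⊆ Set.Ioo a b → s ∈ Set.Ioo α β →
        ‖e (u s) - e (⨍ t in Set.Ioo α β, u t)‖ₑ ≤ 2 * ∫⁻ r in Set.Ioo α β, ‖v r‖ₑ := by
  obtain ⟨S, hS, hle⟩ := h.ae_enorm_sub_le hab hu
  filter_upwards [hS] with s hsS α β hαβ hs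
  by_cases htop : 2 * ∫⁻ r in Set.Ioo α β, ‖v r‖ₑ = ∞
  · simp [htop]
  have hαβ' : α < β := hs.1.trans hs.2
  have hui : IntegrableOn u (Set.Ioo α β) := hu.mono_set hαβ
  -- Almost every value lies in this closed ball, which is convex, so the mean does too.
  have hmem : ⨍ t in Set.Ioo α β, e (u t) ∈
      Metric.closedBall (e (u s)) (2 * ∫⁻ r in Set.Ioo α β, ‖v r‖ₑ).toReal := by
    refine (convex_closedBall _ _).set_average_mem Metric.isClosed_closedBall ?_ ?_ ?_
      (e.integrable_comp hui)
    · simpa using hαβ'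
    · simp
    · filter_upwards [ae_restrict_mem measurableSet_Ioo, ae_restrict_of_ae hS] with t ht htS
      rw [Metric.mem_closedBall, dist_comm, dist_eq_norm, ← toReal_enorm]
      exact ENNReal.toReal_mono htop (hle α β hαβ s ⟨hsS, hs⟩ t ⟨htS, ht⟩)
  have hav : e (⨍ t in Set.Ioo α β, u t) = ⨍ t in Set.Ioo α β, e (u t) := by
    rw [setAverage_eq, setAverage_eq, map_smul, ContinuousLinearMap.integral_comp_comm _ hui]
  rw [hav, ← ENNReal.ofReal_toReal htop, ← ofReal_norm, ← dist_eq_norm, dist_comm]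
  exact ENNReal.ofReal_le_ofReal hmem

end Oscillation

/-! ### Integrals over sliding windows -/

theorem aemeasurable_indicator_window {ν : Measure ℝ} [SFinite ν] (h : ℝ) {f : ℝ → ℝ≥0∞}
    (hf : AEMeasurable f ν) :
    AEMeasurable (Function.uncurry fun t s => (Set.Ioo (t - h) (t + h)).indicator f s)
      (ν.prod ν) := by
  have hset : MeasurableSet {z : ℝ × ℝ | z.2 ∈ Set.Ioo (z.1 - h) (z.1 + h)} :=
    (measurableSet_lt (f := fun z : ℝ × ℝ => z.1 - h) (g := fun z => z.2)
      (by fun_prop) (by fun_prop)).inter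
    (measurableSet_lt (f := fun z : ℝ × ℝ => z.2) (g := fun z => z.1 + h)
      (by fun_prop) (by fun_prop))
  have h1 : AEMeasurable (fun z : ℝ × ℝ => f z.2) (ν.prod ν) :=
    hf.comp_quasiMeasurePreserving Measure.quasiMeasurePreserving_snd
  exact h1.indicator hset

theorem aemeasurable_window {ν : Measure ℝ} [SFinite ν] (h : ℝ) {f : ℝ → ℝ≥0∞}
    (hf : AEMeasurable f ν) :
    AEMeasurable (fun t => ∫⁻ s in Set.Ioo (t - h) (t + h), f s ∂ν) ν := by
  have := (aemeasurable_indicator_window h hf).lintegral_prod_right'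
  simpa only [Function.uncurry, lintegral_indicator measurableSet_Ioo] using this

/-- The integral of `f` over the interval of radius `h` around a variable point, in the `L^p` norm,
is small with `h` in terms of the `L^q` norm of `f`. -/
theorem exists_eLpNorm_window_le {p q M : ℝ≥0∞} (hp : 1 ≤ p) (hq : 1 ≤ q) (hpq : p = ∞ → 1 < q)
    (hM : M ≠ ∞) {ν : Measure ℝ} [IsFiniteMeasure ν] (hν : ν ≤ volume) :
    ∃ C : ℝ≥0∞, C ≠ ∞ ∧ ∃ θ : ℝ, 0 < θ ∧ ∀ h : ℝ, 0 < h → ∀ f : ℝ → ℝ≥0∞, AEMeasurable f ν →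
      eLpNorm f q ν ≤ M →
      eLpNorm (fun t => ∫⁻ s in Set.Ioo (t - h) (t + h), f s ∂ν) p ν ≤
        C * ENNReal.ofReal (2 * h) ^ θ := by
  have hvol : ∀ t h : ℝ, ν (Set.Ioo (t - h) (t + h)) ≤ ENNReal.ofReal (2 * h) := fun t h => by
    refine (hν _).trans_eq ?_
    rw [Real.volume_Ioo]
    ring_nf
  -- For `p = ∞`, Hölder's inequality on each window gives the power `θ = 1 - 1/q`, positive because
  -- `q > 1`.
  by_cases hptop : p = ∞
  · have hq1 := hpq hptop
    have hθ : 0 < 1 / (1 : ℝ≥0∞).toReal - 1 / q.toReal := by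
      by_cases hqt : q = ∞
      · simp [hqt]
      · have : 1 < q.toReal := by
          simpa using (ENNReal.toReal_lt_toReal ENNReal.one_ne_top hqt).2 hq1
        have h2 : 1 / q.toReal < 1 := by rw [div_lt_one (by linarith)]; exact this
        simpa using h2
    refine ⟨M, hM, _, hθ, fun h hh f hf hfM => ?_⟩
    rw [hptop, eLpNorm_exponent_top]
    refine eLpNormEssSup_le_of_ae_enorm_bound (ae_of_all _ fun t => ?_)
    calc ‖∫⁻ s in Set.Ioo (t - h) (t + h), f s ∂ν‖ₑ
        = eLpNorm f 1 (ν.restrict (Set.Ioo (t - h) (t + h))) := by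
          rw [eLpNorm_one_eq_lintegral_enorm]
          simp
      _ ≤ eLpNorm f q (ν.restrict (Set.Ioo (t - h) (t + h))) *
          (ν.restrict (Set.Ioo (t - h) (t + h))) Set.univ ^
            (1 / (1 : ℝ≥0∞).toReal - 1 / q.toReal) :=
          eLpNorm_le_eLpNorm_mul_rpow_measure_univ hq
            hf.aestronglyMeasurable.restrict
      _ ≤ _ := by
          rw [Measure.restrict_apply_univ]
          gcongr
          · exact (eLpNorm_mono_measure _ Measure.restrict_le_self).trans hfM
          · exact hvol t h
  · have hp1 : 1 ≤ p.toReal := by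
      simpa using (ENNReal.toReal_le_toReal ENNReal.one_ne_top hptop).2 hp
    have hp0 : 0 < p.toReal := by linarith
    -- `V` bounds the `L^1` norm of `f`. The window integral `w` satisfies `w ≤ V` and, by Tonelli,
    -- `∫ w ≤ 2 h V`; then `w ^ p ≤ V ^ (p - 1) * w` gives `θ = 1/p`.
    set V := M * ν Set.univ ^ (1 / (1 : ℝ≥0∞).toReal - 1 / q.toReal) with hV
    have hθ : 0 ≤ 1 / (1 : ℝ≥0∞).toReal - 1 / q.toReal := by
      by_cases hqt : q = ∞
      · simp [hqt]
      · have : 1 ≤ q.toReal := by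
          simpa using (ENNReal.toReal_le_toReal ENNReal.one_ne_top hqt).2 hq
        have h2 : 1 / q.toReal ≤ 1 := by rw [div_le_one (by linarith)]; exact this
        simpa using h2
    have hVtop : V ≠ ∞ :=
      ENNReal.mul_ne_top hM (ENNReal.rpow_ne_top_of_nonneg hθ (measure_ne_top _ _))
    refine ⟨V, hVtop, 1 / p.toReal, by positivity, fun h hh f hf hfM => ?_⟩
    have hfV : ∫⁻ s, f s ∂ν ≤ V := by
      calc ∫⁻ s, f s ∂ν = eLpNorm f 1 ν := by
            rw [eLpNorm_one_eq_lintegral_enorm]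
            simp
        _ ≤ _ := eLpNorm_le_eLpNorm_mul_rpow_measure_univ hq hf.aestronglyMeasurable
        _ ≤ V := by rw [hV]; gcongr
    have hmeas := aemeasurable_indicator_window h hf
    have htot : ∫⁻ t, ∫⁻ s in Set.Ioo (t - h) (t + h), f s ∂ν ∂ν ≤ ENNReal.ofReal (2 * h) * V := by
      calc ∫⁻ t, ∫⁻ s in Set.Ioo (t - h) (t + h), f s ∂ν ∂ν
          = ∫⁻ t, ∫⁻ s, (Set.Ioo (t - h) (t + h)).indicator f s ∂ν ∂ν := by
            simp_rw [lintegral_indicator measurableSet_Ioo]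
        _ = ∫⁻ s, ∫⁻ t, (Set.Ioo (t - h) (t + h)).indicator f s ∂ν ∂ν :=
            lintegral_lintegral_swap hmeas
        _ = ∫⁻ s, ∫⁻ t, (Set.Ioo (s - h) (s + h)).indicator (fun _ => f s) t ∂ν ∂ν := by
            refine lintegral_congr fun s => lintegral_congr fun t => ?_
            have : s ∈ Set.Ioo (t - h) (t + h) ↔ t ∈ Set.Ioo (s - h) (s + h) := by
              constructor <;> rintro ⟨h1, h2⟩ <;> constructor <;> linarith
            by_cases hs : s ∈ Set.Ioo (t - h) (t + h)
            · rw [Set.indicator_of_mem hs, Set.indicator_of_mem (this.1 hs)]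
            · rw [Set.indicator_of_notMem hs, Set.indicator_of_notMem (mt this.2 hs)]
        _ ≤ ∫⁻ s, ENNReal.ofReal (2 * h) * f s ∂ν := by
            refine lintegral_mono fun s => ?_
            rw [lintegral_indicator_const measurableSet_Ioo, mul_comm]
            gcongr
            exact hvol s h
        _ ≤ _ := by
            rw [lintegral_const_mul' _ _ ENNReal.ofReal_ne_top]
            gcongr
    rw [eLpNorm_eq_lintegral_rpow_enorm_toReal (by positivity) hptop]
    have hpow : ∫⁻ t, ‖∫⁻ s in Set.Ioo (t - h) (t + h), f s ∂ν‖ₑ ^ p.toReal ∂ν ≤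
        V ^ p.toReal * ENNReal.ofReal (2 * h) := by
      have hVp : V ^ (p.toReal - 1) ≠ ∞ := ENNReal.rpow_ne_top_of_nonneg (by linarith) hVtop
      have hadd : ∀ x : ℝ≥0∞, x ^ p.toReal = x ^ (p.toReal - 1) * x := fun x => by
        conv_lhs => rw [show p.toReal = (p.toReal - 1) + 1 by ring]
        rw [ENNReal.rpow_add_of_nonneg _ _ (by linarith) zero_le_one, ENNReal.rpow_one]
      calc ∫⁻ t, ‖∫⁻ s in Set.Ioo (t - h) (t + h), f s ∂ν‖ₑ ^ p.toReal ∂ν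
          ≤ ∫⁻ t, V ^ (p.toReal - 1) * ∫⁻ s in Set.Ioo (t - h) (t + h), f s ∂ν ∂ν := by
            refine lintegral_mono fun t => ?_
            rw [enorm_eq_self, hadd]
            gcongr
            exact (setLIntegral_le_lintegral _ _).trans hfV
        _ ≤ V ^ (p.toReal - 1) * (ENNReal.ofReal (2 * h) * V) := by
            rw [lintegral_const_mul' _ _ hVp]
            gcongr
        _ = _ := by rw [hadd V]; ring
    refine (ENNReal.rpow_le_rpow hpow (by positivity)).trans_eq ?_
    rw [ENNReal.mul_rpow_of_nonneg _ _ (by positivity), ← ENNReal.rpow_mul,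
      mul_one_div_cancel hp0.ne', ENNReal.rpow_one]

/-! ### Compactness on bounded intervals -/

section LocalCompactness

variable {E F : Type*} [NormedAddCommGroup E] [NormedSpace ℝ E] [CompleteSpace E]
    [NormedAddCommGroup F] [NormedSpace ℝ F] [CompleteSpace F]

theorem eLpNorm_one_le_of_isFiniteMeasure {G Ω : Type*} [NormedAddCommGroup G] [MeasurableSpace Ω]
    {ν : Measure Ω} [IsFiniteMeasure ν] {p M : ℝ≥0∞} (hp : 1 ≤ p) (hM : M ≠ ∞) :
    ∃ R : ℝ≥0∞, R ≠ ∞ ∧ ∀ u : Ω → G, AEStronglyMeasurable u ν → eLpNorm u p ν ≤ M →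
      eLpNorm u 1 ν ≤ R := by
  have hθ : 0 ≤ 1 / (1 : ℝ≥0∞).toReal - 1 / p.toReal := by
    by_cases hqt : p = ∞
    · simp [hqt]
    · have : 1 ≤ p.toReal := by
        simpa using (ENNReal.toReal_le_toReal ENNReal.one_ne_top hqt).2 hp
      have h2 : 1 / p.toReal ≤ 1 := by rw [div_le_one (by linarith)]; exact this
      simpa using h2
  refine ⟨M * ν Set.univ ^ (1 / (1 : ℝ≥0∞).toReal - 1 / p.toReal),
    ENNReal.mul_ne_top hM (ENNReal.rpow_ne_top_of_nonneg hθ (measure_ne_top _ _)),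
    fun u hu huM => (eLpNorm_le_eLpNorm_mul_rpow_measure_univ hp hu).trans ?_⟩
  gcongr

/-- A family that is bounded in `L^p`, with weak derivatives bounded in `L^q`, becomes relatively
compact in `L^p` on a bounded interval under a compact operator. -/
theorem hasFiniteNets_eLpNorm_of_isWeakDeriv {ι : Type*} {e : E →L[ℝ] F}
    (he : IsCompactOperator e) {I : Set ℝ} {a b : ℝ} (hab : Set.Ioo a b ⊆ interior I)
    {p q M : ℝ≥0∞} (hp : 1 ≤ p) (hq : 1 ≤ q) (hpq : p = ∞ → 1 < q) (hM : M ≠ ∞)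
    {U : ι → ℝ → E} {V : ι → ℝ → F} (hUV : ∀ x, IsWeakDeriv I 1 e (U x) (V x))
    (hUm : ∀ x, AEStronglyMeasurable (U x) (volume.restrict (Set.Ioo a b)))
    (hVm : ∀ x, AEStronglyMeasurable (V x) (volume.restrict (Set.Ioo a b)))
    (hU : ∀ x, eLpNorm (U x) p (volume.restrict (Set.Ioo a b)) ≤ M)
    (hV : ∀ x, eLpNorm (V x) q (volume.restrict (Set.Ioo a b)) ≤ M) :
    HasFiniteNets fun x y =>
      eLpNorm (fun t => e (U x t) - e (U y t)) p (volume.restrict (Set.Ioo a b)) := by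
  refine HasFiniteNets.of_forall_le_add fun ε hε hε' => ?_
  rcases le_or_gt b a with hba | hlt
  · refine ⟨_, hasFiniteNets_edist (g := fun _ => (0 : ℝ)) (K := {0})
      isCompact_singleton.totallyBounded (by simp), 0, by simp, fun x y => ?_⟩
    simp [Set.Ioo_eq_empty hba.not_gt]
  obtain ⟨C, hC, θ, hθ, hwin⟩ := exists_eLpNorm_window_le hp hq hpq hM
    (ν := volume.restrict (Set.Ioo a b)) Measure.restrict_le_self
  obtain ⟨R, hR, hUR⟩ := eLpNorm_one_le_of_isFiniteMeasure (G := E)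
    (ν := volume.restrict (Set.Ioo a b)) hp hM
  have hUi : ∀ x, IntegrableOn (U x) (Set.Ioo a b) := fun x =>
    memLp_one_iff_integrable.1 ⟨hUm x, (hUR _ (hUm x) (hU x)).trans_lt hR.lt_top⟩
  -- The total error from replacing functions by window means. The factor `4` is the `2` of the
  -- oscillation bound, once for each of the two functions compared.
  have hlim : Tendsto (fun N : ℕ =>
      4 * (C * ENNReal.ofReal (2 * (2 * ((b - a) * (1 / ((N : ℝ) + 1))))) ^ θ)) atTop (𝓝 0) := by
    have h1 : Tendsto (fun N : ℕ => 2 * (2 * ((b - a) * (1 / ((N : ℝ) + 1))))) atTop (𝓝 0) := by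
      have := ((tendsto_one_div_add_atTop_nhds_zero_nat (𝕜 := ℝ)).const_mul (b - a)).const_mul 2
      simpa using this.const_mul 2
    have h2 := (ENNReal.continuous_rpow_const (y := θ)).tendsto 0 |>.comp
      (by simpa using ENNReal.tendsto_ofReal h1)
    have h3 := ENNReal.Tendsto.const_mul (a := 4) (ENNReal.Tendsto.const_mul (a := C) h2
      (Or.inr hC)) (Or.inr (by simp))
    simpa [ENNReal.zero_rpow_of_pos hθ] using h3
  obtain ⟨N, hN, hN1⟩ := ((hlim.eventually (gt_mem_nhds hε)).and (eventually_ge_atTop 1)).exists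
  set h : ℝ := (b - a) * (1 / ((N : ℝ) + 1)) with hh
  have hhpos : 0 < h := mul_pos (by linarith) (by positivity)
  have hhN : h * ((N : ℝ) + 1) = b - a := by rw [hh]; field_simp
  -- Windows of length `2 h` at step `h = (b - a)/(N + 1)`: they overlap, so open intervals cover
  -- `(a, b)`, and the last one ends at `b`.
  let S : Fin N → Set ℝ := fun l => Set.Ioo (a + l * h) (a + (l + 2) * h)
  have hS : ∀ l, S l ⊆ Set.Ioo a b := by
    intro l
    refine Set.Ioo_subset_Ioo ?_ ?_
    · have : 0 ≤ (l : ℝ) * h := by positivity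
      linarith
    · have h1 : (l : ℝ) + 1 ≤ N := by exact_mod_cast l.2
      have h2 : ((l : ℝ) + 2) * h ≤ ((N : ℝ) + 1) * h := by
        apply mul_le_mul_of_nonneg_right _ hhpos.le
        linarith
      linarith
  have hcover : ∀ t ∈ Set.Ioo a b, ∃ l, t ∈ S l := by
    intro t ht
    have htn : 0 ≤ (t - a) / h := div_nonneg (by linarith [ht.1]) hhpos.le
    set m := ⌊(t - a) / h⌋₊ with hm
    have h1 : (m : ℝ) * h ≤ t - a := (le_div_iff₀ hhpos).1 (Nat.floor_le htn)
    have h2 : t - a < ((m : ℝ) + 1) * h := (div_lt_iff₀ hhpos).1 (Nat.lt_floor_add_one _)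
    have hmN : m < N + 1 := by
      have : (m : ℝ) * h < ((N : ℝ) + 1) * h := by linarith [ht.2]
      exact_mod_cast lt_of_mul_lt_mul_right this hhpos.le
    -- With `m` the integer part, the window `m - 1` contains `t` even when `t = a + m h`; for `m =
    -- 0` the window `0` is used.
    rcases Nat.eq_zero_or_pos m with h0 | h0
    · refine ⟨⟨0, hN1⟩, ?_, ?_⟩
      · simpa using ht.1
      · rw [h0] at h2
        simp only [Nat.cast_zero] at h2 ⊢
        linarith
    · obtain ⟨k, hk⟩ := Nat.exists_eq_add_of_lt h0
      have hk' : m = k + 1 := by omega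
      refine ⟨⟨k, by omega⟩, ?_, ?_⟩
      · rw [hk'] at h1
        push_cast at h1 ⊢
        linarith
      · rw [hk'] at h2
        push_cast at h2 ⊢
        linarith
  -- The means of one function form a point of `F^N`, confined to a product of compact sets since
  -- `e` is compact and the `L^1` norms are bounded.
  let g : ι → Fin N → F := fun x l => e (⨍ t in S l, U x t)
  have hg : ∀ x, g x ∈ Set.univ.pi fun _ : Fin N =>
      closure (e '' Metric.closedBall 0 ((2 * h)⁻¹ * R.toReal)) := by
    intro x l _
    refine subset_closure ⟨_, ?_, rfl⟩
    rw [mem_closedBall_zero_iff, setAverage_eq, norm_smul, norm_inv]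
    have hvol : volume.real (S l) = 2 * h := by
      rw [Real.volume_real_Ioo_of_le] <;> nlinarith
    rw [hvol, Real.norm_of_nonneg (by positivity)]
    gcongr
    refine (norm_integral_le_integral_norm _).trans ?_
    refine (setIntegral_mono_set (hUi x).norm (ae_of_all _ fun _ => norm_nonneg _)
      (hS l).eventuallyLE).trans ?_
    rw [integral_norm_eq_lintegral_enorm (hUm x), ← eLpNorm_one_eq_lintegral_enorm]
    exact ENNReal.toReal_mono hR (hUR _ (hUm x) (hU x))
  have hK : TotallyBounded (Set.univ.pi fun _ : Fin N =>
      closure (e '' Metric.closedBall 0 ((2 * h)⁻¹ * R.toReal))) :=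
    (isCompact_univ_pi fun _ => IsCompactOperator.isCompact_closure_image_closedBall
      (f := (e : E →ₗ[ℝ] F)) he _).totallyBounded
  -- Radius `2 h`, so that the window around `t` contains every `S l` with `t ∈ S l`.
  let W : ι → ℝ → ℝ≥0∞ := fun x t =>
    ∫⁻ s in Set.Ioo (t - 2 * h) (t + 2 * h), ‖V x s‖ₑ ∂(volume.restrict (Set.Ioo a b))
  have hWm : ∀ x, AEStronglyMeasurable (W x) (volume.restrict (Set.Ioo a b)) := fun x =>
    (aemeasurable_window _ (hVm x).enorm).aestronglyMeasurable
  have hWle : ∀ x, eLpNorm (W x) p (volume.restrict (Set.Ioo a b)) ≤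
      C * ENNReal.ofReal (2 * (2 * h)) ^ θ := fun x =>
    hwin (2 * h) (by positivity) _ (hVm x).enorm (by
      refine le_trans (le_of_eq ?_) (hV x)
      exact eLpNorm_congr_enorm_ae (ae_of_all _ fun _ => enorm_eq_self _))
  have hloc : ∀ x, ∀ᵐ t ∂volume.restrict (Set.Ioo a b), ∀ l, t ∈ S l →
      edist (e (U x t)) (g x l) ≤ W x t + W x t := by
    intro x
    filter_upwards [ae_restrict_of_ae ((hUV x).ae_enorm_sub_average_le hab (hUi x))] with t ht l htl
    rw [edist_eq_enorm_sub]
    refine (ht _ _ (hS l) htl).trans ?_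
    rw [two_mul]
    have hle : ∫⁻ r in S l, ‖V x r‖ₑ ≤ W x t := by
      change _ ≤ ∫⁻ s in Set.Ioo (t - 2 * h) (t + 2 * h), ‖V x s‖ₑ ∂(volume.restrict (Set.Ioo a b))
      rw [Measure.restrict_restrict measurableSet_Ioo]
      refine lintegral_mono_set fun r hr => ⟨⟨?_, ?_⟩, hS l hr⟩
      · linarith [htl.2, hr.1]
      · linarith [htl.1, hr.2]
    exact add_le_add hle hle
  refine ⟨_, hasFiniteNets_edist hK hg, volume.restrict (Set.Ioo a b) Set.univ ^ p.toReal⁻¹,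
    ENNReal.rpow_ne_top_of_nonneg (by positivity) (measure_ne_top _ _), fun x y => ?_⟩
  have hpt : ∀ᵐ t ∂volume.restrict (Set.Ioo a b), ‖e (U x t) - e (U y t)‖ₑ ≤
      ‖(((W x + W x) + (W y + W y)) + (fun _ => edist (g x) (g y)) : ℝ → ℝ≥0∞) t‖ₑ := by
    filter_upwards [hloc x, hloc y, ae_restrict_mem measurableSet_Ioo] with t hx hy ht
    obtain ⟨l, hl⟩ := hcover t ht
    rw [enorm_eq_self, ← edist_eq_enorm_sub]
    calc edist (e (U x t)) (e (U y t))
        ≤ edist (e (U x t)) (g x l) + edist (g x l) (g y l) + edist (g y l) (e (U y t)) :=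
          edist_triangle4 _ _ _ _
      _ ≤ (W x t + W x t) + edist (g x) (g y) + (W y t + W y t) := by
          refine add_le_add (add_le_add (hx l hl) (edist_le_pi_edist _ _ l)) ?_
          rw [edist_comm]
          exact hy l hl
      _ = _ := by
          simp only [Pi.add_apply]
          ring
  have hxx := (hWm x).add (hWm x)
  have hyy := (hWm y).add (hWm y)
  have hc : eLpNorm (fun _ : ℝ => edist (g x) (g y)) p (volume.restrict (Set.Ioo a b)) ≤
      volume.restrict (Set.Ioo a b) Set.univ ^ p.toReal⁻¹ * edist (g x) (g y) := by
    refine (eLpNorm_le_of_ae_enorm_bound (C := edist (g x) (g y)) (ae_of_all _ fun _ => ?_)).trans_eq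
      (by rw [smul_eq_mul, mul_comm])
    rw [enorm_eq_self]
  calc _ ≤ _ := eLpNorm_mono_enorm_ae hpt
    _ ≤ _ := eLpNorm_add_le (hxx.add hyy) aestronglyMeasurable_const hp
    _ ≤ (_ + _) + _ := add_le_add (eLpNorm_add_le hxx hyy hp) hc
    _ ≤ ((_ + _) + (_ + _)) + _ := add_le_add (add_le_add (eLpNorm_add_le (hWm x) (hWm x) hp)
        (eLpNorm_add_le (hWm y) (hWm y) hp)) le_rfl
    _ ≤ 4 * (C * ENNReal.ofReal (2 * (2 * h)) ^ θ) + _ := by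
        refine add_le_add ((add_le_add (add_le_add (hWle x) (hWle x))
          (add_le_add (hWle y) (hWle y))).trans_eq (by ring)) le_rfl
    _ ≤ _ := add_le_add hN.le le_rfl

end LocalCompactness

/-! ### Weak derivatives under linear maps and iteration -/

section WeakDerivComp

variable {E E' F F' : Type*} [NormedAddCommGroup E] [NormedSpace ℝ E]
    [NormedAddCommGroup E'] [NormedSpace ℝ E'] [NormedAddCommGroup F] [NormedSpace ℝ F]
    [NormedAddCommGroup F'] [NormedSpace ℝ F']

theorem ContinuousLinearMap.locallyIntegrableOn_comp_interior {I : Set ℝ} (e : E →L[ℝ] F)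
    {u : ℝ → E} (hu : LocallyIntegrableOn u (interior I)) :
    LocallyIntegrableOn (fun t => e (u t)) (interior I) := by
  rw [locallyIntegrableOn_iff isOpen_interior.isLocallyClosed] at hu ⊢
  exact fun K hK hKc => e.integrable_comp (hu K hK hKc)

theorem IsWeakDeriv.clm_comp [CompleteSpace F] [CompleteSpace F'] {I : Set ℝ} {k : ℕ}
    {c : E →L[ℝ] F} {u : ℝ → E} {v : ℝ → F} (h : IsWeakDeriv I k c u v) {c' : E' →L[ℝ] F'}
    {e : E →L[ℝ] E'} {f : F →L[ℝ] F'} (hc : ∀ x, c' (e x) = f (c x)) :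
    IsWeakDeriv I k c' (fun t => e (u t)) (fun t => f (v t)) := by
  refine ⟨e.locallyIntegrableOn_comp_interior h.1, f.locallyIntegrableOn_comp_interior h.2.1,
    fun φ hφ hφc hs => ?_⟩
  have h1 := (integrable_iteratedDeriv_smul k c hφ hφc hs h.1).integrableOn (s := I)
  have h2 := (integrable_test_smul hφ.continuous hφc hs h.2.1).integrableOn (s := I)
  have h3 := congrArg f (h.2.2 φ hφ hφc hs)
  rw [map_smul, ← ContinuousLinearMap.integral_comp_comm _ h1,
    ← ContinuousLinearMap.integral_comp_comm _ h2] at h3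
  simpa only [hc, map_smul] using h3

/-- The weak derivative of order `k + 1` is the first weak derivative of the one of order `k`. -/
theorem IsWeakDeriv.succ_of [CompleteSpace F] [CompleteSpace F'] {I : Set ℝ} {k : ℕ}
    {c : E →L[ℝ] F} {e : F →L[ℝ] F'} {u : ℝ → E} {v : ℝ → F} {w : ℝ → F'}
    (h : IsWeakDeriv I k c u v) (h' : IsWeakDeriv I (k + 1) (e.comp c) u w) :
    IsWeakDeriv I 1 e v w := by
  refine ⟨h.2.1, h'.2.1, fun φ hφ hφc hs => ?_⟩
  have hφd : ContDiff ℝ (⊤ : ℕ∞) (_root_.deriv φ) := (contDiff_infty_iff_deriv.1 hφ).2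
  obtain ⟨-, hdc, hds⟩ := iteratedDeriv_test 1 hφ hφc hs
  rw [iteratedDeriv_one] at hdc hds
  have h1 := (integrable_iteratedDeriv_smul k c hφd hdc hds h.1).integrableOn (s := I)
  have h2 := (integrable_test_smul hφd.continuous hdc hds h.2.1).integrableOn (s := I)
  -- The order `k` identity is tested with `φ'` and the order `k + 1` identity with `φ`; the left
  -- sides agree, and the common sign `(-1)^k` cancels.
  have h3 := congrArg e (h.2.2 _ hφd hdc hds)
  rw [map_smul, ← ContinuousLinearMap.integral_comp_comm _ h1,
    ← ContinuousLinearMap.integral_comp_comm _ h2] at h3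
  have h4 := h'.2.2 φ hφ hφc hs
  simp only [iteratedDeriv_succ', ContinuousLinearMap.comp_apply] at h4
  simp only [map_smul] at h3
  rw [h3, pow_succ, mul_smul] at h4
  rw [pow_one, iteratedDeriv_one]
  exact smul_right_injective F' (pow_ne_zero k (by norm_num : (-1 : ℝ) ≠ 0)) h4

end WeakDerivComp

/-! ### Comparison of weights -/

theorem exists_interior_inter_Ioo_eq (I : Set ℝ) [I.OrdConnected] (R : ℝ) :
    ∃ a b, interior I ∩ Set.Ioo (-R) R = Set.Ioo a b := by
  set s := interior I ∩ Set.Ioo (-R) R with hs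
  rcases s.eq_empty_or_nonempty with h0 | hne
  · exact ⟨0, 0, by rw [h0, Set.Ioo_self]⟩
  have hopen : IsOpen s := isOpen_interior.inter isOpen_Ioo
  have hconn : IsConnected s :=
    ⟨hne, ((Set.OrdConnected.convex (s := I) inferInstance).interior.inter
      (convex_Ioo _ _)).isPreconnected⟩
  have hb : BddBelow s := bddBelow_Ioo.mono Set.inter_subset_right
  have ha : BddAbove s := bddAbove_Ioo.mono Set.inter_subset_right
  refine ⟨sInf s, sSup s, (Set.Subset.antisymm ?_ (hconn.Ioo_csInf_csSup_subset hb ha))⟩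
  rw [← interior_Icc]
  exact interior_maximal (subset_Icc_csInf_csSup hb ha) hopen

theorem exists_forall_abs_le_weight_le (ω : C(ℝ, Set.Ioi (0 : ℝ))) (R : ℝ) :
    ∃ c C : ℝ, 0 < c ∧ 0 < C ∧ ∀ t ∈ Set.Icc (-R) R, c ≤ ω t ∧ (ω t : ℝ) ≤ C := by
  have hcont : Continuous fun t => (ω t : ℝ) := continuous_subtype_val.comp ω.continuous
  obtain ⟨c, hc, hcle⟩ := (isCompact_Icc (a := -R) (b := R)).exists_forall_le' (a := 0)
    hcont.continuousOn fun t _ => (ω t).2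
  obtain ⟨C, hC⟩ := (isCompact_Icc (a := -R) (b := R)).exists_bound_of_continuousOn
    hcont.continuousOn
  exact ⟨c, max C 1, hc, by positivity, fun t ht => ⟨hcle t ht,
    ((le_abs_self _).trans (hC t ht)).trans (le_max_left _ _)⟩⟩

theorem exists_forall_le_mul_of_tendsto_div {ω ω' : C(ℝ, Set.Ioi (0 : ℝ))}
    (htop : Tendsto (fun t => (ω' t : ℝ) / ω t) atTop (𝓝 0))
    (hbot : Tendsto (fun t => (ω' t : ℝ) / ω t) atBot (𝓝 0)) {δ : ℝ} (hδ : 0 < δ) :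
    ∃ R : ℝ, ∀ t, t ∉ Set.Ioo (-R) R → (ω' t : ℝ) ≤ δ * ω t := by
  obtain ⟨A, hA⟩ := eventually_atTop.1 (htop.eventually (gt_mem_nhds hδ))
  obtain ⟨B, hB⟩ := eventually_atBot.1 (hbot.eventually (gt_mem_nhds hδ))
  refine ⟨max A (-B), fun t ht => ?_⟩
  have hpos : (0 : ℝ) < ω t := (ω t).2
  rw [Set.mem_Ioo, not_and_or, not_lt, not_lt] at ht
  rcases ht with ht | ht
  · exact ((div_lt_iff₀ hpos).1 (hB t (by linarith [le_max_right A (-B)]))).le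
  · exact ((div_lt_iff₀ hpos).1 (hA t ((le_max_left _ _).trans ht))).le

/-- Far out the quotient is at most `1` because it tends to `0`; on the remaining compact interval
both weights have positive bounds. -/
theorem exists_weight_le_mul {ω ω' : C(ℝ, Set.Ioi (0 : ℝ))}
    (htop : Tendsto (fun t => (ω' t : ℝ) / ω t) atTop (𝓝 0))
    (hbot : Tendsto (fun t => (ω' t : ℝ) / ω t) atBot (𝓝 0)) :
    ∃ C : ℝ, 0 < C ∧ ∀ t, (ω' t : ℝ) ≤ C * ω t := by
  obtain ⟨R, hR⟩ := exists_forall_le_mul_of_tendsto_div htop hbot one_pos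
  obtain ⟨c, _, hc, _, h⟩ := exists_forall_abs_le_weight_le ω R
  obtain ⟨_, C, _, hC, h'⟩ := exists_forall_abs_le_weight_le ω' R
  refine ⟨max 1 (C / c), by positivity, fun t => ?_⟩
  have hpos : (0 : ℝ) < ω t := (ω t).2
  by_cases ht : t ∈ Set.Ioo (-R) R
  · have ht' := Set.Ioo_subset_Icc_self ht
    calc (ω' t : ℝ) ≤ C / c * c := by rw [div_mul_cancel₀ _ hc.ne']; exact (h' t ht').2
      _ ≤ max 1 (C / c) * ω t := by
        gcongr
        · exact le_max_right _ _
        · exact (h t ht').1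
  · refine (hR t ht).trans ?_
    gcongr
    exact le_max_left _ _

theorem eLpNorm_restrict_Ioo_le {G : Type*} [NormedAddCommGroup G] [NormedSpace ℝ G]
    {ω : C(ℝ, Set.Ioi (0 : ℝ))} {a b c : ℝ} {μ : Measure ℝ} (hc : 0 < c)
    (hω : ∀ t ∈ Set.Ioo a b, c ≤ ω t) (hμ : volume.restrict (Set.Ioo a b) ≤ μ)
    (r : ℝ≥0∞) (f : ℝ → G) :
    eLpNorm f r (volume.restrict (Set.Ioo a b)) ≤
      ENNReal.ofReal c⁻¹ * eLpNorm (fun t => (ω t : ℝ) • f t) r μ := by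
  refine (eLpNorm_le_mul_eLpNorm_of_ae_le_mul (c := c⁻¹)
    (g := fun t => (ω t : ℝ) • f t) ?_ r).trans (mul_le_mul_right (eLpNorm_mono_measure _ hμ) _)
  filter_upwards [ae_restrict_mem measurableSet_Ioo] with t ht
  rw [norm_smul, Real.norm_of_nonneg (ω t).2.le, inv_mul_eq_div, le_div_iff₀ hc, mul_comm]
  gcongr
  exact hω t ht

/-! ### The weighted Aubin-Lions-Simon lemma -/

section Weighted

variable {X Y Z : Type*} [NormedAddCommGroup X] [NormedSpace ℝ X]
    [NormedAddCommGroup Y] [NormedSpace ℝ Y] [NormedAddCommGroup Z] [NormedSpace ℝ Z]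

/-- Ehrling's inequality with weights. -/
theorem IsCompactOperator.exists_weight_mul_norm_le {i : X →L[ℝ] Y} (hi : IsCompactOperator i)
    {j : Y →L[ℝ] Z} (hj : Function.Injective j) {ω ω' : C(ℝ, Set.Ioi (0 : ℝ))}
    (htop : Tendsto (fun t => (ω' t : ℝ) / ω t) atTop (𝓝 0))
    (hbot : Tendsto (fun t => (ω' t : ℝ) / ω t) atBot (𝓝 0)) {ε : ℝ} (hε : 0 < ε) :
    ∃ R K : ℝ, 0 ≤ K ∧ ∀ t x, (ω' t : ℝ) * ‖i x‖ ≤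
      ε * (ω t * ‖x‖) + (Set.Ioo (-R) R).indicator (fun _ => K * ‖j (i x)‖) t := by
  obtain ⟨C, hC, hωC⟩ := exists_weight_le_mul htop hbot
  -- Outside `(-R, R)` the decay of the quotient absorbs `‖i‖`. Inside, Ehrling's inequality is used
  -- with `ε / C` to compensate for `ω' ≤ C ω`.
  obtain ⟨R, hR⟩ := exists_forall_le_mul_of_tendsto_div htop hbot
    (δ := ε / (‖i‖ + 1)) (by positivity)
  obtain ⟨_, C', _, hC', h'⟩ := exists_forall_abs_le_weight_le ω' R
  obtain ⟨B, hB, hEhr⟩ := hi.exists_norm_le_add hj (η := ε / C) (by positivity)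
  refine ⟨R, C' * B, by positivity, fun t x => ?_⟩
  have hpos : (0 : ℝ) < ω t := (ω t).2
  have hpos' : (0 : ℝ) < ω' t := (ω' t).2
  by_cases ht : t ∈ Set.Ioo (-R) R
  · rw [Set.indicator_of_mem ht]
    calc (ω' t : ℝ) * ‖i x‖ ≤ ω' t * (ε / C * ‖x‖ + B * ‖j (i x)‖) := by
          gcongr
          exact hEhr x
      _ = ω' t * (ε / C * ‖x‖) + ω' t * (B * ‖j (i x)‖) := by ring
      _ ≤ C * ω t * (ε / C * ‖x‖) + C' * (B * ‖j (i x)‖) := by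
          gcongr
          · exact hωC t
          · exact (h' t (Set.Ioo_subset_Icc_self ht)).2
      _ = _ := by field_simp
  · rw [Set.indicator_of_notMem ht, add_zero]
    calc (ω' t : ℝ) * ‖i x‖ ≤ (ε / (‖i‖ + 1) * ω t) * ((‖i‖ + 1) * ‖x‖) := by
          gcongr
          · exact hR t ht
          · refine (i.le_opNorm x).trans ?_
            gcongr
            linarith
      _ = _ := by field_simp

variable [CompleteSpace X] [CompleteSpace Z]

/-- The weighted Aubin-Lions-Simon lemma. -/
theorem hasFiniteNets_weighted_of_isWeakDeriv {ι : Type*} {i : X →L[ℝ] Y}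
    (hi : IsCompactOperator i) {j : Y →L[ℝ] Z} (hj : Function.Injective j)
    {ω ω' : C(ℝ, Set.Ioi (0 : ℝ))}
    (htop : Tendsto (fun t => (ω' t : ℝ) / ω t) atTop (𝓝 0))
    (hbot : Tendsto (fun t => (ω' t : ℝ) / ω t) atBot (𝓝 0))
    {I : Set ℝ} [I.OrdConnected] {p q M : ℝ≥0∞} (hp : 1 ≤ p) (hq : 1 ≤ q)
    (hpq : p = ∞ → 1 < q) (hM : M ≠ ∞) {U : ι → ℝ → X} {V : ι → ℝ → Z}
    (hUV : ∀ x, IsWeakDeriv I 1 (j.comp i) (U x) (V x))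
    (hUm : ∀ x, AEStronglyMeasurable (U x) (volume.restrict I))
    (hVm : ∀ x, AEStronglyMeasurable (V x) (volume.restrict I))
    (hU : ∀ x, eLpNorm (fun t => (ω t : ℝ) • U x t) p (volume.restrict I) ≤ M)
    (hV : ∀ x, eLpNorm (fun t => (ω t : ℝ) • V x t) q (volume.restrict I) ≤ M) :
    HasFiniteNets fun x y =>
      eLpNorm (fun t => (ω' t : ℝ) • i (U x t) - (ω' t : ℝ) • i (U y t)) p
        (volume.restrict I) := by
  -- The end points are null; on the open interior, truncation to `(-R, R)` yields an open interval.
  rw [← restrict_interior_eq I] at *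
  have hωc : Continuous fun t => (ω t : ℝ) := continuous_subtype_val.comp ω.continuous
  refine HasFiniteNets.of_forall_le_add fun ε hε hε' => ?_
  have hεr : 0 < ε.toReal := ENNReal.toReal_pos hε.ne' hε'
  -- The difference of two members has weighted norm at most `2 M`, and `δ * 2 M ≤ ε`; the `1`
  -- covers `M = 0`.
  set δ : ℝ := ε.toReal / (2 * M.toReal + 1) with hδ
  have hδpos : 0 < δ := by positivity
  have hδM : ENNReal.ofReal δ * (M + M) ≤ ε := by
    rw [← ENNReal.ofReal_toReal hM, ← ENNReal.ofReal_add (by positivity) (by positivity),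
      ← ENNReal.ofReal_mul hδpos.le]
    refine ENNReal.ofReal_le_of_le_toReal ?_
    rw [hδ, div_mul_eq_mul_div, div_le_iff₀ (by positivity)]
    nlinarith
  obtain ⟨R, K, hK, hle⟩ := hi.exists_weight_mul_norm_le hj htop hbot hδpos
  obtain ⟨a, b, hab⟩ := exists_interior_inter_Ioo_eq I R
  obtain ⟨c, _, hc, _, hcω⟩ := exists_forall_abs_le_weight_le ω R
  have hab' : Set.Ioo a b ⊆ interior I := hab ▸ Set.inter_subset_left
  have hrestr : (volume.restrict (interior I)).restrict (Set.Ioo (-R) R) =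
      volume.restrict (Set.Ioo a b) := by
    rw [Measure.restrict_restrict measurableSet_Ioo, Set.inter_comm, hab]
  have hω : ∀ t ∈ Set.Ioo a b, c ≤ ω t := fun t ht =>
    (hcω t (Set.Ioo_subset_Icc_self (hab ▸ ht :).2)).1
  have hmono : volume.restrict (Set.Ioo a b) ≤ volume.restrict (interior I) :=
    Measure.restrict_mono hab' le_rfl
  refine ⟨_, hasFiniteNets_eLpNorm_of_isWeakDeriv (e := j.comp i) (hi.clm_comp j) hab' hp hq hpq
    (M := ENNReal.ofReal c⁻¹ * M) (ENNReal.mul_ne_top ENNReal.ofReal_ne_top hM) hUV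
    (fun x => (hUm x).mono_measure hmono) (fun x => (hVm x).mono_measure hmono)
    (fun x => (eLpNorm_restrict_Ioo_le hc hω hmono p (U x)).trans (by gcongr; exact hU x))
    (fun x => (eLpNorm_restrict_Ioo_le hc hω hmono q (V x)).trans (by gcongr; exact hV x)),
    ENNReal.ofReal K, ENNReal.ofReal_ne_top, fun x y => ?_⟩
  have hωU : ∀ x, AEStronglyMeasurable (fun t => (ω t : ℝ) • U x t)
      (volume.restrict (interior I)) := fun x => hωc.aestronglyMeasurable.smul (hUm x)
  have hm2 : AEStronglyMeasurable (fun t => j (i (U x t)) - j (i (U y t)))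
      (volume.restrict (interior I)) :=
    ((j.comp i).continuous.comp_aestronglyMeasurable (hUm x)).sub
      ((j.comp i).continuous.comp_aestronglyMeasurable (hUm y))
  -- `f₁` and `f₂` are the two terms of the weighted Ehrling bound for `U x - U y`: a small one on
  -- all of `I`, and one living on the bounded interval where nets exist.
  set f₁ : ℝ → ℝ := δ • fun t => ‖(ω t : ℝ) • U x t - (ω t : ℝ) • U y t‖ with hf₁
  set f₂ : ℝ → ℝ := (Set.Ioo (-R) R).indicator
    (K • fun t => ‖j (i (U x t)) - j (i (U y t))‖) with hf₂
  have hpt : ∀ t, ‖(ω' t : ℝ) • i (U x t) - (ω' t : ℝ) • i (U y t)‖ ≤ (f₁ + f₂) t := by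
    intro t
    have h1 := hle t (U x t - U y t)
    simp only [map_sub] at h1
    rw [← smul_sub, norm_smul, Real.norm_of_nonneg (ω' t).2.le]
    refine h1.trans_eq ?_
    simp only [hf₁, hf₂, Pi.add_apply, Pi.smul_apply, smul_eq_mul, ← smul_sub, norm_smul,
      Real.norm_of_nonneg (ω t).2.le]
    rfl
  calc _ ≤ eLpNorm (f₁ + f₂) p (volume.restrict (interior I)) := eLpNorm_mono_real hpt
    _ ≤ eLpNorm f₁ p (volume.restrict (interior I)) + eLpNorm f₂ p (volume.restrict (interior I)) :=
        eLpNorm_add_le (((hωU x).sub (hωU y)).norm.const_smul δ)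
          ((hm2.norm.const_smul K).indicator measurableSet_Ioo) hp
    _ ≤ _ := by
        refine add_le_add ?_ (le_of_eq ?_)
        · rw [hf₁, eLpNorm_const_smul, Real.enorm_of_nonneg hδpos.le, eLpNorm_norm]
          refine le_trans ?_ hδM
          gcongr
          exact (eLpNorm_sub_le (hωU x) (hωU y) hp).trans (add_le_add (hU x) (hU y))
        · rw [hf₂, eLpNorm_indicator_eq_eLpNorm_restrict measurableSet_Ioo, hrestr,
            eLpNorm_const_smul, Real.enorm_of_nonneg hK, eLpNorm_norm]
          rfl

end Weighted

/-! ### Completeness of the Bochner-Sobolev space -/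

/-- This is the Hölder pairing with `ψ`, which lies in `L^p'` for the conjugate exponent, including
`p = ∞`. -/
theorem continuous_integral_smul_Lp {E : Type*} [NormedAddCommGroup E] [NormedSpace ℝ E]
    [CompleteSpace E] {μ : Measure ℝ} [IsFiniteMeasureOnCompacts μ] {p : ℝ≥0∞} [hp : Fact (1 ≤ p)]
    {ψ : ℝ → ℝ} (hψ : Continuous ψ) (hψc : HasCompactSupport ψ) :
    Continuous fun g : Lp E p μ => ∫ t, ψ t • g t ∂μ := by
  have hconj : p.HolderConjugate p.conjExponent := ENNReal.HolderConjugate.conjExponent hp.out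
  have : p.conjExponent.HolderConjugate p := hconj.symm
  have : Fact (1 ≤ p.conjExponent) := ⟨ENNReal.HolderConjugate.one_le _ p⟩
  have hmem : MemLp ψ p.conjExponent μ := hψ.memLp_of_hasCompactSupport hψc
  have h := (ContinuousLinearMap.lpPairing μ p.conjExponent p
    (ContinuousLinearMap.lsmul ℝ ℝ : ℝ →L[ℝ] E →L[ℝ] E) hmem.toLp).continuous
  refine h.congr fun g => ?_
  rw [ContinuousLinearMap.lpPairing_eq_integral]
  refine integral_congr_ae ?_
  filter_upwards [hmem.coeFn_toLp] with t ht
  rw [ht]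
  rfl

theorem locallyIntegrableOn_inv_weight_smul {E : Type*} [NormedAddCommGroup E] [NormedSpace ℝ E]
    {I : Set ℝ} {p : ℝ≥0∞} (hp : 1 ≤ p) (ω : C(ℝ, Set.Ioi (0 : ℝ))) {f : ℝ → E}
    (hf : MemLp f p (volume.restrict I)) :
    LocallyIntegrableOn (fun t => (ω t : ℝ)⁻¹ • f t) (interior I) := by
  have hω : Continuous fun t => (ω t : ℝ)⁻¹ :=
    (continuous_subtype_val.comp ω.continuous).inv₀ fun t => (ω t).2.ne'
  rw [locallyIntegrableOn_iff isOpen_interior.isLocallyClosed]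
  intro K hK hKc
  have h1 : IntegrableOn f K := by
    have h2 : MemLp f p (volume.restrict K) :=
      hf.mono_measure (Measure.restrict_mono (hK.trans interior_subset) le_rfl)
    have : IsFiniteMeasure (volume.restrict K) := ⟨by simpa using hKc.measure_lt_top⟩
    exact h2.integrable hp
  exact h1.continuousOn_smul hω.continuousOn hKc

namespace BochnerSobolev

variable {X : ℕ → Type*} [∀ k, NormedAddCommGroup (X k)] {n : ℕ} {p : ℕ → ℝ≥0∞} {I : Set ℝ}

/-- The entry of index `0`, with the value `0` of the index coerced to `ℕ`. -/
noncomputable def zerothEntry [∀ k, Fact (1 ≤ p k)]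
    (f : PiLp 1 (fun k : Fin (n + 1) => Lp (X k) (p k) (volume.restrict I))) :
    Lp (X 0) (p 0) (volume.restrict I) := f 0

theorem continuous_zerothEntry [∀ k, Fact (1 ≤ p k)] :
    Continuous (zerothEntry (X := X) (n := n) (p := p) (I := I)) :=
  PiLp.continuous_apply 1 (fun k : Fin (n + 1) => Lp (X k) (p k) (volume.restrict I)) 0

variable [∀ k, NormedSpace ℝ (X k)] {ι : ∀ k, X k →L[ℝ] X (k + 1)} {ω : C(ℝ, Set.Ioi (0 : ℝ))}
  [I.OrdConnected]

theorem weightedDerivs_apply [∀ k, CompleteSpace (X k)] [∀ k, Fact (1 ≤ p k)]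
    (u : BochnerSobolev n ι p ω I) (k : Fin (n + 1)) :
    weightedDerivs u k = (u.memLp_deriv k).toLp := rfl

/-- A tuple `f` comes from some `u` exactly when `ω⁻¹ f 0` has the weak derivatives `ω⁻¹ f k`.
Keeping `chainMap` outside the integral makes each identity visibly a closed condition on `f`. -/
theorem range_weightedDerivs [∀ k, CompleteSpace (X k)] [∀ k, Fact (1 ≤ p k)] :
    Set.range (weightedDerivs (n := n) (ι := ι) (p := p) (ω := ω) (I := I)) =
      ⋂ (k : Fin (n + 1)) (φ : ℝ → ℝ) (_ : ContDiff ℝ (⊤ : ℕ∞) φ) (_ : HasCompactSupport φ)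
        (_ : tsupport φ ⊆ interior I),
        {f | chainMap ι k (∫ t in I, (iteratedDeriv k φ t * (ω t : ℝ)⁻¹) • zerothEntry f t) =
          (-1 : ℝ) ^ (k : ℕ) • ∫ t in I, (φ t * (ω t : ℝ)⁻¹) • f k t} := by
  have hint : ∀ (k : Fin (n + 1)) (φ : ℝ → ℝ), ContDiff ℝ (⊤ : ℕ∞) φ → HasCompactSupport φ →
      tsupport φ ⊆ interior I →
      ∀ f : Lp (X 0) (p 0) (volume.restrict I),
      chainMap ι k (∫ t in I, (iteratedDeriv k φ t * (ω t : ℝ)⁻¹) • f t) =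
        ∫ t in I, iteratedDeriv k φ t • chainMap ι k ((ω t : ℝ)⁻¹ • f t) := by
    intro k φ hφ hφc hs f
    have h1 := locallyIntegrableOn_inv_weight_smul Fact.out ω (Lp.memLp f)
    obtain ⟨h2, h3, h4⟩ := iteratedDeriv_test k hφ hφc hs
    rw [← ContinuousLinearMap.integral_comp_comm]
    · simp only [mul_smul, map_smul]
    · simp only [mul_smul]
      exact (integrable_test_smul h2 h3 h4 h1).integrableOn
  ext f
  simp only [Set.mem_range, Set.mem_iInter, Set.mem_ofPred_eq]
  constructor
  · rintro ⟨u, rfl⟩ k φ hφ hφc hs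
    rw [hint k φ hφ hφc hs]
    have h0 : ∀ l : Fin (n + 1), ∀ᵐ t ∂volume.restrict I,
        (ω t : ℝ)⁻¹ • weightedDerivs u l t = u.deriv l t := fun l => by
      filter_upwards [(u.memLp_deriv l).coeFn_toLp] with t ht
      rw [weightedDerivs_apply, ht, smul_smul, inv_mul_cancel₀ (ω t).2.ne', one_smul]
    have h00 : ∀ᵐ t ∂volume.restrict I,
        (ω t : ℝ)⁻¹ • zerothEntry (weightedDerivs u) t = u.toAEEqFun t := by
      filter_upwards [h0 0, u.deriv_zero] with t ht ht'
      exact ht.trans ht'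
    have h1 := (u.isWeakDeriv_deriv k).2.2 φ hφ hφc hs
    refine Eq.trans ?_ (h1.trans ?_)
    · refine integral_congr_ae ?_
      filter_upwards [h00] with t ht
      rw [ht]
    · congr 1
      refine integral_congr_ae ?_
      filter_upwards [h0 k] with t ht
      rw [mul_smul, ht]
  · intro hf
    have hω : Continuous fun t => (ω t : ℝ)⁻¹ :=
      (continuous_subtype_val.comp ω.continuous).inv₀ fun t => (ω t).2.ne'
    have hm : ∀ k : Fin (n + 1), AEStronglyMeasurable (fun t => (ω t : ℝ)⁻¹ • f k t)
        (volume.restrict I) := fun k =>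
      hω.aestronglyMeasurable.smul (Lp.aestronglyMeasurable _)
    have hm0 : AEStronglyMeasurable (fun t => (ω t : ℝ)⁻¹ • zerothEntry f t)
        (volume.restrict I) := hm 0
    have hli := fun k : Fin (n + 1) =>
      locallyIntegrableOn_inv_weight_smul Fact.out ω (Lp.memLp (f k))
    have hweak : ∀ k : Fin (n + 1), IsWeakDeriv I k (chainMap ι k)
        (AEEqFun.mk _ hm0) (AEEqFun.mk _ (hm k)) := fun k => by
      refine IsWeakDeriv.congr (u := fun t => (ω t : ℝ)⁻¹ • zerothEntry f t)
        (v := fun t => (ω t : ℝ)⁻¹ • f k t) ⟨hli 0, hli k, fun φ hφ hφc hs => ?_⟩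
        (AEEqFun.coeFn_mk _ _).symm (AEEqFun.coeFn_mk _ _).symm
      rw [← hint k φ hφ hφc hs, hf k φ hφ hφc hs]
      simp only [mul_smul]
    have hcancel' : ∀ k : Fin (n + 1), (fun t => (ω t : ℝ) • AEEqFun.mk _ (hm k) t)
        =ᵐ[volume.restrict I] f k := fun k => by
      filter_upwards [AEEqFun.coeFn_mk _ (hm k)] with t ht
      rw [ht, smul_smul, mul_inv_cancel₀ (ω t).2.ne', one_smul]
    let u : BochnerSobolev n ι p ω I := ⟨AEEqFun.mk _ hm0, fun k hk =>
      ⟨AEEqFun.mk _ (hm ⟨k, Nat.lt_succ_of_le hk⟩), hweak ⟨k, Nat.lt_succ_of_le hk⟩,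
        (Lp.memLp (f ⟨k, Nat.lt_succ_of_le hk⟩)).ae_eq (hcancel' _).symm⟩⟩
    refine ⟨u, ?_⟩
    apply WithLp.ofLp_injective
    funext k
    change (u.memLp_deriv k).toLp = f k
    refine Lp.ext ((u.memLp_deriv k).coeFn_toLp.trans ?_)
    filter_upwards [(u.isWeakDeriv_deriv k).unique (hweak k), hcancel' k] with t ht ht'
    rw [ht, ht']

theorem isClosed_range_weightedDerivs [∀ k, CompleteSpace (X k)] [∀ k, Fact (1 ≤ p k)] :
    IsClosed (Set.range (weightedDerivs (n := n) (ι := ι) (p := p) (ω := ω) (I := I))) := by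
  have hω : Continuous fun t => (ω t : ℝ)⁻¹ :=
    (continuous_subtype_val.comp ω.continuous).inv₀ fun t => (ω t).2.ne'
  rw [range_weightedDerivs]
  refine isClosed_iInter fun k => isClosed_iInter fun φ => isClosed_iInter fun hφ =>
    isClosed_iInter fun hφc => isClosed_iInter fun hs => isClosed_eq ?_ ?_
  · obtain ⟨h2, h3, -⟩ := iteratedDeriv_test k hφ hφc hs
    exact (chainMap ι k).continuous.comp
      ((continuous_integral_smul_Lp (h2.mul hω) h3.mul_right).comp
        continuous_zerothEntry)
  · exact ((continuous_integral_smul_Lp (hφ.continuous.mul hω) hφc.mul_right).comp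
        (PiLp.continuous_apply 1 _ k)).const_smul _

theorem isClosedEmbedding_weightedDerivs [∀ k, CompleteSpace (X k)] [∀ k, Fact (1 ≤ p k)] :
    IsClosedEmbedding (weightedDerivs (n := n) (ι := ι) (p := p) (ω := ω) (I := I)) := by
  have hiso : Isometry (weightedDerivs (n := n) (ι := ι) (p := p) (ω := ω) (I := I)) :=
    AddMonoidHomClass.isometry_of_norm _ fun u => rfl
  exact ⟨hiso.isEmbedding, isClosed_range_weightedDerivs⟩

theorem eLpNorm_deriv_le [∀ k, CompleteSpace (X k)] [∀ k, Fact (1 ≤ p k)]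
    (u : BochnerSobolev n ι p ω I) (k : Fin (n + 1)) :
    eLpNorm (fun t => (ω t : ℝ) • u.deriv k t) (p k) (volume.restrict I) ≤
      ENNReal.ofReal ‖u‖ := by
  rw [ENNReal.le_ofReal_iff_toReal_le (u.memLp_deriv k).2.ne (norm_nonneg u), norm_eq]
  exact Finset.single_le_sum (f := fun k : Fin (n + 1) =>
    (eLpNorm (fun t => (ω t : ℝ) • u.deriv k t) (p k) (volume.restrict I)).toReal)
    (fun _ _ => ENNReal.toReal_nonneg) (Finset.mem_univ k)

/-- A map into a Bochner-Sobolev space is a compact operator if all the weighted derivatives of the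
images of the unit ball form totally bounded families. -/
theorem isCompactOperator_of_hasFiniteNets [∀ k, CompleteSpace (X k)] [∀ k, Fact (1 ≤ p k)]
    {E : Type*} [SeminormedAddCommGroup E] {J : E → BochnerSobolev n ι p ω I}
    (h : ∀ k : Fin (n + 1), HasFiniteNets fun x y : Metric.closedBall (0 : E) 1 =>
      eLpNorm (fun t => (ω t : ℝ) • (J x).deriv k t - (ω t : ℝ) • (J y).deriv k t) (p k)
        (volume.restrict I)) : IsCompactOperator J := by
  let K : ∀ k : Fin (n + 1), Set (Lp (X k) (p k) (volume.restrict I)) := fun k =>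
    closure (Set.range fun x : Metric.closedBall (0 : E) 1 => weightedDerivs (J x) k)
  have hK : ∀ k, IsCompact (K k) := fun k => by
    refine TotallyBounded.isCompact_of_isClosed (TotallyBounded.closure ?_) isClosed_closure
    refine HasFiniteNets.totallyBounded ?_
    simp only [weightedDerivs_apply, Lp.edist_toLp_toLp]
    exact h k
  -- The image of the unit ball sits in a product of compact sets, whose preimage under the closed
  -- embedding `weightedDerivs` is compact.
  have hcomp : IsCompact (WithLp.toLp 1 '' Set.univ.pi K) :=
    (isCompact_univ_pi hK).image (PiLp.continuous_toLp 1 _)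
  refine ⟨_, isClosedEmbedding_weightedDerivs.isCompact_preimage hcomp, ?_⟩
  filter_upwards [Metric.closedBall_mem_nhds (0 : E) one_pos] with x hx
  exact ⟨_, fun k _ => subset_closure ⟨⟨x, hx⟩, rfl⟩, rfl⟩

end BochnerSobolev

/-! ### The embedding and its compactness -/

namespace BochnerSobolev

variable {X : ℕ → Type*} [∀ k, NormedAddCommGroup (X k)] [∀ k, NormedSpace ℝ (X k)]
  {Y : ℕ → Type*} [∀ k, NormedAddCommGroup (Y k)] [∀ k, NormedSpace ℝ (Y k)]
  {i : ∀ k, X k →L[ℝ] Y k} {j : ∀ k, Y k →L[ℝ] X (k + 1)}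

/-- Both sides are the same alternating chain from `X 0` to `Y k`, bracketed differently. -/
theorem chainMap_comp_apply (k : ℕ) (x : X 0) :
    chainMap (fun k => (i (k + 1)).comp (j k)) k (i 0 x) =
      i k (chainMap (fun k => (j k).comp (i k)) k x) := by
  induction k with
  | zero => rfl
  | succ k ih => simp only [chainMap, ContinuousLinearMap.comp_apply, ih]

variable {m : ℕ} {p : ℕ → ℝ≥0∞}
  {ω ω' : C(ℝ, Set.Ioi (0 : ℝ))} {I : Set ℝ} [I.OrdConnected]

theorem memLp_comp_deriv {C : ℝ} (hC : ∀ t, (ω' t : ℝ) ≤ C * ω t)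
    (u : BochnerSobolev (m + 1) (fun k => (j k).comp (i k)) p ω I)
    (k : ℕ) (hk : k < m + 1 + 1) :
    MemLp (fun t => (ω' t : ℝ) • AEEqFun.comp (i k) (i k).continuous (u.deriv ⟨k, hk⟩) t) (p k)
      (volume.restrict I) := by
  have hω' : Continuous fun t => (ω' t : ℝ) := continuous_subtype_val.comp ω'.continuous
  refine (u.memLp_deriv ⟨k, hk⟩).of_le_mul (c := C * ‖i k‖)
    (hω'.aestronglyMeasurable.smul (AEEqFun.aestronglyMeasurable _)) ?_
  filter_upwards [AEEqFun.coeFn_comp (i k) (i k).continuous (u.deriv ⟨k, hk⟩)] with t ht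
  rw [ht, Function.comp_apply, norm_smul, norm_smul, Real.norm_of_nonneg (ω t).2.le,
    Real.norm_of_nonneg (ω' t).2.le]
  have hpos : (0 : ℝ) < ω' t := (ω' t).2
  calc (ω' t : ℝ) * ‖i k (u.deriv ⟨k, hk⟩ t)‖
      ≤ (C * ω t) * (‖i k‖ * ‖u.deriv ⟨k, hk⟩ t‖) :=
        mul_le_mul (hC t) ((i k).le_opNorm _) (norm_nonneg _) (hpos.le.trans (hC t))
    _ = _ := by ring

variable [∀ k, CompleteSpace (X k)] [∀ k, CompleteSpace (Y k)]

theorem isWeakDeriv_comp_deriv (u : BochnerSobolev (m + 1) (fun k => (j k).comp (i k)) p ω I)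
    (k : ℕ) (hk : k < m + 1 + 1) :
    IsWeakDeriv I k (chainMap (fun k => (i (k + 1)).comp (j k)) k)
      (AEEqFun.comp (i 0) (i 0).continuous u.toAEEqFun)
      (AEEqFun.comp (i k) (i k).continuous (u.deriv ⟨k, hk⟩)) :=
  ((u.isWeakDeriv_deriv ⟨k, hk⟩).clm_comp (e := i 0) (f := i k)
    (chainMap_comp_apply k)).congr
    (AEEqFun.coeFn_comp _ (i 0).continuous _).symm (AEEqFun.coeFn_comp _ (i k).continuous _).symm

/-- Composition with the maps `i k`, from order `m + 1` in the spaces `X k` to order `m` in the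
spaces `Y k`. -/
noncomputable def compEmbedding {C : ℝ} (hC : ∀ t, (ω' t : ℝ) ≤ C * ω t) :
    BochnerSobolev (m + 1) (fun k => (j k).comp (i k)) p ω I →ₗ[ℝ]
      BochnerSobolev m (fun k => (i (k + 1)).comp (j k)) p ω' I where
  toFun u := ⟨AEEqFun.comp (i 0) (i 0).continuous u.toAEEqFun, fun k hk =>
    ⟨_, isWeakDeriv_comp_deriv u k (by omega), memLp_comp_deriv hC u k (by omega)⟩⟩
  map_add' u v := by
    apply Subtype.ext
    change AEEqFun.comp (i 0) (i 0).continuous (u.toAEEqFun + v.toAEEqFun) =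
      AEEqFun.comp (i 0) (i 0).continuous u.toAEEqFun +
        AEEqFun.comp (i 0) (i 0).continuous v.toAEEqFun
    apply AEEqFun.ext
    refine (AEEqFun.coeFn_comp _ (i 0).continuous _).trans
      (EventuallyEq.trans ?_ (AEEqFun.coeFn_add _ _).symm)
    filter_upwards [AEEqFun.coeFn_add u.toAEEqFun v.toAEEqFun,
      AEEqFun.coeFn_comp (i 0) (i 0).continuous u.toAEEqFun,
      AEEqFun.coeFn_comp (i 0) (i 0).continuous v.toAEEqFun] with t ht h1 h2
    refine (congrArg (i 0) ht).trans ?_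
    rw [Pi.add_apply, map_add]
    exact congrArg₂ (· + ·) h1.symm h2.symm
  map_smul' c u := by
    apply Subtype.ext
    change AEEqFun.comp (i 0) (i 0).continuous (c • u.toAEEqFun) =
      c • AEEqFun.comp (i 0) (i 0).continuous u.toAEEqFun
    apply AEEqFun.ext
    refine (AEEqFun.coeFn_comp _ (i 0).continuous _).trans
      (EventuallyEq.trans ?_ (AEEqFun.coeFn_smul _ _).symm)
    filter_upwards [AEEqFun.coeFn_smul c u.toAEEqFun,
      AEEqFun.coeFn_comp (i 0) (i 0).continuous u.toAEEqFun] with t ht h1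
    refine (congrArg (i 0) ht).trans ?_
    rw [Pi.smul_apply, map_smul]
    exact congrArg (c • ·) h1.symm

theorem compEmbedding_ae_eq {C : ℝ} (hC : ∀ t, (ω' t : ℝ) ≤ C * ω t)
    (u : BochnerSobolev (m + 1) (fun k => (j k).comp (i k)) p ω I) :
    (compEmbedding hC u).toAEEqFun =ᵐ[volume.restrict I] fun t => i 0 (u.toAEEqFun t) :=
  AEEqFun.coeFn_comp _ (i 0).continuous _

theorem compEmbedding_deriv_ae_eq {C : ℝ} (hC : ∀ t, (ω' t : ℝ) ≤ C * ω t)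
    (u : BochnerSobolev (m + 1) (fun k => (j k).comp (i k)) p ω I) (k : ℕ) (hk : k < m + 1) :
    (compEmbedding hC u).deriv ⟨k, hk⟩ =ᵐ[volume.restrict I]
      fun t => i k (u.deriv ⟨k, by omega⟩ t) :=
  (((compEmbedding hC u).isWeakDeriv_deriv ⟨k, hk⟩).unique
    (isWeakDeriv_comp_deriv u k (by omega))).trans (AEEqFun.coeFn_comp _ (i k).continuous _)

theorem compEmbedding_injective {C : ℝ} (hC : ∀ t, (ω' t : ℝ) ≤ C * ω t)
    (hi : Function.Injective (i 0)) :
    Function.Injective (compEmbedding (i := i) (j := j) (p := p) (I := I) (m := m) hC) := by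
  intro u v h
  apply Subtype.ext
  apply AEEqFun.ext
  have h' : (compEmbedding hC u).toAEEqFun = (compEmbedding hC v).toAEEqFun := by rw [h]
  have hv := compEmbedding_ae_eq hC v
  rw [← h'] at hv
  filter_upwards [compEmbedding_ae_eq hC u, hv] with t h1 h2
  exact hi (h1.symm.trans h2)

/-- For each `k ≤ m` the weighted lemma is applied with `u^(k)` as the function and `u^(k+1)` as its
derivative. The derivative of top order serves only as a bound, so one order is lost. -/
theorem isCompactOperator_compEmbedding [∀ k, Fact (1 ≤ p k)]
    (hic : ∀ k < m + 1, IsCompactOperator (i k)) (hj : ∀ k < m + 1, Function.Injective (j k))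
    (hp : ∀ k < m + 1, p k = ∞ → 1 < p (k + 1))
    (htop : Tendsto (fun t => (ω' t : ℝ) / ω t) atTop (𝓝 0))
    (hbot : Tendsto (fun t => (ω' t : ℝ) / ω t) atBot (𝓝 0))
    {C : ℝ} (hC : ∀ t, (ω' t : ℝ) ≤ C * ω t) :
    IsCompactOperator (compEmbedding (i := i) (j := j) (p := p) (I := I) (m := m) hC) := by
  refine isCompactOperator_of_hasFiniteNets ?_
  rintro ⟨k, hk⟩
  have hbound : ∀ (u : Metric.closedBall
      (0 : BochnerSobolev (m + 1) (fun k => (j k).comp (i k)) p ω I) 1) (l : Fin (m + 1 + 1)),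
      eLpNorm (fun t => (ω t : ℝ) • u.1.deriv l t) (p l) (volume.restrict I) ≤ 1 := fun u l => by
    refine (eLpNorm_deriv_le u.1 l).trans ?_
    rw [ENNReal.ofReal_le_one]
    exact mem_closedBall_zero_iff.1 u.2
  have hnets := hasFiniteNets_weighted_of_isWeakDeriv (hic k hk) (hj k hk) htop hbot (I := I)
    (p := p k) (q := p (k + 1)) (M := 1) Fact.out Fact.out (hp k hk) ENNReal.one_ne_top
    (U := fun u : Metric.closedBall
      (0 : BochnerSobolev (m + 1) (fun k => (j k).comp (i k)) p ω I) 1 =>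
        u.1.deriv ⟨k, by omega⟩)
    (V := fun u => u.1.deriv ⟨k + 1, by omega⟩)
    (fun u => (u.1.isWeakDeriv_deriv ⟨k, by omega⟩).succ_of
      (u.1.isWeakDeriv_deriv ⟨k + 1, by omega⟩))
    (fun u => AEEqFun.aestronglyMeasurable _) (fun u => AEEqFun.aestronglyMeasurable _)
    (fun u => hbound u ⟨k, by omega⟩) (fun u => hbound u ⟨k + 1, by omega⟩)
  refine hnets.congr fun u v => ?_
  refine eLpNorm_congr_ae ?_
  filter_upwards [compEmbedding_deriv_ae_eq hC u.1 k hk,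
    compEmbedding_deriv_ae_eq hC v.1 k hk] with t hu hv
  rw [hu, hv]

end BochnerSobolev

/-- The tuple `(X_n, …, X_0)` of the Banach spaces is numbered in the order of listing:
`X k`, `Y k`, `p k` stand for `X_{n-k}`, `Y_{n-1-k}`, `p_{n-k}`. So the chain is
`X 0 → Y 0 → X 1 → Y 1 → ⋯ → X (n-1) → Y (n-1) → X n`, the `k`-th derivative takes values in `X k`,
and `i k : X k → Y k`, `j k : Y k → X (k+1)` are the embeddings. Only the entries of index at most
`n` (for `Y`, `i`, `j`: at most `n - 1`) matter. -/
theorem proposition2p14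
    {X : ℕ → Type*} [∀ k, NormedAddCommGroup (X k)] [∀ k, NormedSpace ℝ (X k)]
    [∀ k, CompleteSpace (X k)]
    {Y : ℕ → Type*} [∀ k, NormedAddCommGroup (Y k)] [∀ k, NormedSpace ℝ (Y k)]
    [∀ k, CompleteSpace (Y k)]
    (n : ℕ) (hn : 1 ≤ n)
    (hX : ∀ k ≤ n, IsReflexiveSpace (X k))
    (i : ∀ k, X k →L[ℝ] Y k) (j : ∀ k, Y k →L[ℝ] X (k + 1))
    (hi : ∀ k < n, Function.Injective (i k)) (hic : ∀ k < n, IsCompactOperator (i k))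
    (hj : ∀ k < n, Function.Injective (j k))
    (I : Set ℝ) [I.OrdConnected] (hI : (0 : ℝ) ∈ I)
    (p : ℕ → ℝ≥0∞) [∀ k, Fact (1 ≤ p k)]
    (hp : ∀ k < n, p k = ∞ → 1 < p (k + 1))
    (ω : ℕ → C(ℝ, Set.Ioi (0 : ℝ))) (hω : IsScaledWeights ω) :
    ∃ J : BochnerSobolev n (fun k => (j k).comp (i k)) p (ω n) I →L[ℝ]
        BochnerSobolev (n - 1) (fun k => (i (k + 1)).comp (j k)) p (ω (n - 1)) I,
      (∀ u, (J u).toAEEqFun =ᵐ[volume.restrict I] fun t => i 0 (u.toAEEqFun t)) ∧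
      Function.Injective J ∧ IsCompactOperator J := by
  obtain ⟨m, rfl⟩ : ∃ m, n = m + 1 := ⟨n - 1, by omega⟩
  obtain ⟨-, -, -, -, htop, hbot, -, -⟩ := hω m (m + 1) (Nat.lt_succ_self m)
  obtain ⟨C, -, hC⟩ := exists_weight_le_mul htop hbot
  have hcomp := BochnerSobolev.isCompactOperator_compEmbedding (I := I) hic hj hp htop hbot hC
  -- A compact linear operator is continuous, so no separate norm estimate is needed.
  exact ⟨⟨BochnerSobolev.compEmbedding hC, hcomp.continuous⟩,
    BochnerSobolev.compEmbedding_ae_eq hC,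
    BochnerSobolev.compEmbedding_injective hC (hi 0 (Nat.succ_pos m)), hcomp⟩
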